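/- Let $X$ be a separable real Hilbert space, $T\in\mathbb R$, and let $U(t,s)\in\mathcal L(X)$ ($0\le s\le t\le T$), $B(t)\in\mathcal L(X)$ and $f(t)\in X$ ($0\le t\le T$) satisfy: (H1) (i) $U(t,t)=I$, $U(t,s)U(s,r)=U(t,r)$ for $0\le r\le s\le t\le T$, and $(s,t)\mapsto U(t,s)x$ is continuous on $\{0\le s\le t\le T\}$ for every $x\in X$; (ii) $\sup_{t}\|B(t)\|_{\mathcal L(X)}<\infty$ and $t\mapsto B(t)x$ is measurable for every $x\in X$; (iii) $f$ is bounded and measurable; (iv) for $0\le s\le t\le T$ the operator $$Q(t,s)x=\int_s^t U(t,r)B(r)B^*(r)U^*(t,r)x\,dr$$ is bounded, symmetric, nonnegative and has finite trace. (H2) $U(t,s)(X)\subseteq Q(t,s)^{1/2}(X)$ for $0\le s<t\le T$. Put $\Lambda(t,s)=Q(t,s)^{-1/2}U(t,s)$, where $Q(t,s)^{-1/2}$ is the pseudo-inverse of $Q(t,s)^{1/2}$, and assume that for some $C\in\mathbb R$ and $\theta>0$ $$\|\Lambda(t,s)\|_{\mathcal L(X)}\le C(t-s)^{-\theta},\qquad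 0\le s<t\le T .$$ For a bounded Borel function $\varphi:X\to\mathbb R$ and $0\le s<t\le T$ let $$P_{s,t}\varphi(x)=\int_X\varphi(y)\,\mathcal N_{m^x(t,s),Q(t,s)}(dy),\qquad m^x(t,s)=U(t,s)x+\int_s^tU(t,r)f(r)\,dr,$$ where $\mathcal N_{m,Q}$ is the Gaussian measure on $X$ with mean $m$ and covariance operator $Q$. Then: 1. For every integer $n\ge1$ there is $K_n>0$ such that for all $0\le s<t\le T$ and all bounded Borel $\varphi$, $P_{s,t}\varphi$ is $n$ times continuously Fréchet differentiable and $$\|D^nP_{s,t}\varphi(x)\|_{\mathcal L^n(X)}\le\frac{K_n}{(t-s)^{n\theta}}\,\|\varphi\|_\infty,\qquad x\in X.$$ 2. For every $\alpha\in(0,1)$ and every integer $n\ge1$ there is $K_{n,\alpha}>0$ such that for all $0\le s<t\le T$ and all $\varphi\in C^\alpha_b(X)$ (bounded, $\alpha$-Hölder continuous), $P_{s,t}\varphi$ is $n$ times continuously Fréchet differentiable and $$\|D^nP_{s,t}\varphi(x)\|_{\mathcal L^n(X)}\le\frac{K_{n,\alpha}}{(t-s)^{(n-\alpha)\theta}}\,\|\varphi\|_{C^\alpha_b(X)},\qquad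 x\in X,$$ where $\|\varphi\|_{C^\alpha_b(X)}=\sup_{x}|\varphi(x)|+\sup_{x,\,h\ne0}|\varphi(x+h)-\varphi(x)|/\|h\|^\alpha$. The constants $K_n$ and $K_{n,\alpha}$ do not depend on $s,t,x,\varphi$. -/

import Mathlib

open MeasureTheory ProbabilityTheory Set

noncomputable section

namespace OUEvolution

variable {X : Type*} [NormedAddCommGroup X] [InnerProductSpace ℝ X]

/-- The positive square root of an operator `Q`: the (unique) bounded, symmetric, nonnegative
operator `R` with `R² = Q`. It exists for every bounded, symmetric, nonnegative `Q`; the value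
`0` for other maps `Q` is a convention. -/
def opSqrt (Q : X → X) : X →L[ℝ] X :=
  open Classical in
  if h : ∃ R : X →L[ℝ] X, R.IsPositive ∧ ∀ x, R (R x) = Q x then h.choose else 0

/-- The pseudo-inverse of `R` on its range: `pinv R y` is the (unique) element of
`R⁻¹{y} ∩ (ker R)ᗮ`, that is, the element of `R⁻¹{y}` of minimal norm.
Outside the range of `R` the value is `0` by convention. -/
def pinv (R : X →L[ℝ] X) (y : X) : X :=
  open Classical in
  if h : ∃ x : X, x ∈ (LinearMap.ker (R : X →ₗ[ℝ] X))ᗮ ∧ R x = y then h.choose else 0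

/-- The map `Q` is a bounded, symmetric, nonnegative linear operator with finite trace. -/
def IsNonnegTraceClass (Q : X → X) : Prop :=
  ∃ A : X →L[ℝ] X, (∀ x, A x = Q x) ∧ A.IsPositive ∧
    ∃ (w : Set X) (b : HilbertBasis w ℝ X), Summable fun i => inner ℝ (A (b i)) (b i)

/-- `μ` is a Gaussian measure with mean `m` and covariance operator `Q`. -/
def IsGaussianMeasureWith [CompleteSpace X] [MeasurableSpace X] [BorelSpace X]
    (m : X) (Q : X → X) (μ : Measure X) : Prop :=
  IsGaussian μ ∧ ∫ y, y ∂μ = m ∧ ∀ y z : X, covarianceBilin μ y z = inner ℝ (Q y) z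

/-- The Gaussian measure `𝒩_{m,Q}`: the (unique) Gaussian measure with mean `m` and covariance
operator `Q`. On a separable Hilbert space it exists for every bounded, symmetric, nonnegative
`Q` with finite trace; the value `0` for other maps `Q` is a convention. -/
def gaussianMeasure [CompleteSpace X] [MeasurableSpace X] [BorelSpace X]
    (m : X) (Q : X → X) : Measure X :=
  open Classical in
  if h : ∃ μ : Measure X, IsGaussianMeasureWith m Q μ then h.choose else 0

/-- `Q(t,s) x = ∫_s^t U(t,r) B(r) B*(r) U*(t,r) x dr`. -/
def covOp [CompleteSpace X] (U : ℝ → ℝ → X →L[ℝ] X) (B : ℝ → X →L[ℝ] X) (t s : ℝ) (x : X) : X :=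
  ∫ r in s..t, U t r (B r ((B r).adjoint ((U t r).adjoint x)))

/-- `m^x(t,s) = U(t,s) x + ∫_s^t U(t,r) f(r) dr`. -/
def meanVec (U : ℝ → ℝ → X →L[ℝ] X) (f : ℝ → X) (t s : ℝ) (x : X) : X :=
  U t s x + ∫ r in s..t, U t r (f r)

/-- `Λ(t,s) x = Q(t,s)^{-1/2} U(t,s) x`. -/
def lam [CompleteSpace X] (U : ℝ → ℝ → X →L[ℝ] X) (B : ℝ → X →L[ℝ] X) (t s : ℝ) (x : X) : X :=
  pinv (opSqrt (covOp U B t s)) (U t s x)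

/-- `P_{s,t} φ(x) = ∫ φ d𝒩_{m^x(t,s), Q(t,s)}`. -/
def evol [CompleteSpace X] [MeasurableSpace X] [BorelSpace X]
    (U : ℝ → ℝ → X →L[ℝ] X) (B : ℝ → X →L[ℝ] X) (f : ℝ → X)
    (s t : ℝ) (φ : X → ℝ) (x : X) : ℝ :=
  ∫ y, φ y ∂(gaussianMeasure (meanVec U f t s x) (covOp U B t s))

/-- The standing assumptions on the evolution operator `U(t,s) = U t s`, `0 ≤ s ≤ t ≤ T`, the
operators `B(t)` and the function `f`; values outside these time ranges are irrelevant. -/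
structure H1 [CompleteSpace X] (T : ℝ) (U : ℝ → ℝ → X →L[ℝ] X) (B : ℝ → X →L[ℝ] X)
    (f : ℝ → X) : Prop where
  continuous_U : ∀ x : X,
    ContinuousOn (fun p : ℝ × ℝ => U p.2 p.1 x) {p | 0 ≤ p.1 ∧ p.1 ≤ p.2 ∧ p.2 ≤ T}
  U_self : ∀ t, 0 ≤ t → t ≤ T → U t t = ContinuousLinearMap.id ℝ X
  U_comp : ∀ r s t, 0 ≤ r → r ≤ s → s ≤ t → t ≤ T → (U t s).comp (U s r) = U t r
  bounded_B : ∃ b : ℝ, ∀ t ∈ Icc 0 T, ‖B t‖ ≤ b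
  measurable_B : ∀ x : X, AEStronglyMeasurable (fun t => B t x) (volume.restrict (Icc 0 T))
  bounded_f : ∃ b : ℝ, ∀ t ∈ Icc 0 T, ‖f t‖ ≤ b
  measurable_f : AEStronglyMeasurable f (volume.restrict (Icc 0 T))
  traceClass_Q : ∀ s t, 0 ≤ s → s ≤ t → t ≤ T → IsNonnegTraceClass (covOp U B t s)

/-- `U(t,s)(X) ⊆ Q(t,s)^{1/2}(X)` for `0 ≤ s < t ≤ T`. -/
def H2 [CompleteSpace X] (T : ℝ) (U : ℝ → ℝ → X →L[ℝ] X) (B : ℝ → X →L[ℝ] X) : Prop :=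
  ∀ s t, 0 ≤ s → s < t → t ≤ T → range (U t s) ⊆ range (opSqrt (covOp U B t s))

/-- `‖Λ(t,s)‖ ≤ C (t-s)^{-θ}` in operator norm, for `0 ≤ s < t ≤ T`. -/
def LamBound [CompleteSpace X] (T : ℝ) (U : ℝ → ℝ → X →L[ℝ] X) (B : ℝ → X →L[ℝ] X)
    (C θ : ℝ) : Prop :=
  ∀ s t, 0 ≤ s → s < t → t ≤ T → ∀ x, ‖lam U B t s x‖ ≤ C * (t - s) ^ (-θ) * ‖x‖

/-- `φ ∈ B_b(X)`: bounded and Borel measurable. -/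
def IsBddBorel [MeasurableSpace X] (φ : X → ℝ) : Prop :=
  Measurable φ ∧ ∃ b : ℝ, ∀ x, |φ x| ≤ b

/-- `‖φ‖_∞`. -/
def supNorm (φ : X → ℝ) : ℝ := ⨆ x, |φ x|

/-- `φ ∈ C^α_b(X)`, for `α ∈ (0,1)`: bounded, continuous and `α`-Hölder. -/
def IsBddHolder (α : ℝ) (φ : X → ℝ) : Prop :=
  Continuous φ ∧ (∃ b : ℝ, ∀ x, |φ x| ≤ b) ∧
    ∃ c : ℝ, ∀ x h, |φ (x + h) - φ x| ≤ c * ‖h‖ ^ α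

/-- `[φ]_{C^α}`. -/
def holderSeminorm (α : ℝ) (φ : X → ℝ) : ℝ :=
  ⨆ p : X × {h : X // h ≠ 0}, |φ (p.1 + p.2) - φ p.1| / ‖(p.2 : X)‖ ^ α

/-- `‖φ‖_{C^α_b} = ‖φ‖_∞ + [φ]_{C^α}`. -/
def holderNorm (α : ℝ) (φ : X → ℝ) : ℝ := supNorm φ + holderSeminorm α φ

end OUEvolution

end

/-! For bounded Borel data the smoothing comes from the Cameron–Martin formula. Let `R` be the
square root of Q(t,s) and let `Y` be a centred Gaussian vector with covariance `R²`, the image under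
`R` of an isonormal process `W`. Then E ψ(Ra + Y) = exp(-‖a‖²/2) E[ψ(Y) exp(W a)]
(`IsImageOfNoise.integral_shift_eq`), so `a` no longer enters through the rough function ψ but
through an explicit weight. Expanding exp(W a) gives a power series with coefficients E[ψ(Y)
W(·)⋯W(·)]/n!, which Gaussian moments control. Hence the n-th derivative at `a = 0` is at most a
constant times ‖ψ‖_∞ (`contDiffAt_wick`), and translating ψ moves this bound to every point. By
(H2), U = RΛ, so P_{s,t}φ is such a function composed with Λ, and the chain rule produces the factor
‖Λ‖ⁿ (`contDiff_evol`).

For Hölder data, P_{s,t} turns translation by Uh into translation by h. Consequently, on a function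
with Lipschitz constant L, the derivative of order n+1 costs only the n-th power of ‖Λ‖ times L‖U‖
(`norm_iteratedFDeriv_evol_le_of_lipschitz`). An inf-convolution g of φ satisfies |φ - g| ≤ Hε^α and
has Lipschitz constant Hε^(α-1) (`exists_lipschitz_approx`). Applying the first bound to φ - g and
the second to g, the choice ε = (t-s)^θ gives both terms the same power of t-s. -/

noncomputable section

namespace OUEvolution

/-! ### Square roots of positive operators via the Catalan series -/

section Sqrt

theorem catalan_succ_div_pow (n : ℕ) : (catalan (n + 1) : ℝ) / 4 ^ (n + 1) =
    (∑ ij ∈ Finset.HasAntidiagonal.antidiagonal n,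
      ((catalan ij.1 : ℝ) / 4 ^ ij.1) * ((catalan ij.2 : ℝ) / 4 ^ ij.2)) / 4 := by
  rw [catalan_succ']
  push_cast
  rw [Finset.sum_div, Finset.sum_div]
  refine Finset.sum_congr rfl fun ij hij => ?_
  rw [← Finset.HasAntidiagonal.mem_antidiagonal.1 hij, pow_succ, pow_add]
  field_simp

/-- The recursion bounds each partial sum by p ↦ 1 + p²/4 at the previous one, since the pairs with
i + j < N form part of the full square. This map sends [0, 2] into itself. -/
theorem sum_range_catalan_div_le (N : ℕ) :
    ∑ n ∈ Finset.range N, (catalan n : ℝ) / 4 ^ n ≤ 2 := by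
  induction N with
  | zero => simp
  | succ N ih =>
    rw [Finset.sum_range_succ']
    have h0 : 0 ≤ ∑ n ∈ Finset.range N, (catalan n : ℝ) / 4 ^ n :=
      Finset.sum_nonneg fun _ _ => by positivity
    have key : ∑ n ∈ Finset.range N, (catalan (n + 1) : ℝ) / 4 ^ (n + 1) ≤
        (∑ n ∈ Finset.range N, (catalan n : ℝ) / 4 ^ n) ^ 2 / 4 := by
      simp_rw [catalan_succ_div_pow]
      rw [← Finset.sum_div, sq, Finset.sum_mul_sum, ← Finset.sum_product']
      gcongr
      set F : ℕ × ℕ → ℝ := fun x => ((catalan x.1 : ℝ) / 4 ^ x.1) * ((catalan x.2 : ℝ) / 4 ^ x.2)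
      have h2 : ∀ n ∈ Finset.range N, ∑ x ∈ Finset.HasAntidiagonal.antidiagonal n, F x =
          ∑ x ∈ ((Finset.range N ×ˢ Finset.range N).filter fun x => x.1 + x.2 < N) with
            x.1 + x.2 = n, F x := by
        intro n hn
        refine Finset.sum_congr ?_ fun _ _ => rfl
        ext x
        simp only [Finset.mem_range, Finset.HasAntidiagonal.mem_antidiagonal, Finset.mem_filter,
          Finset.mem_product] at hn ⊢
        omega
      rw [Finset.sum_congr rfl h2, Finset.sum_fiberwise_of_maps_to
        (by intro x hx; simpa using (Finset.mem_filter.1 hx).2)]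
      exact Finset.sum_le_sum_of_subset_of_nonneg (Finset.filter_subset _ _)
        fun _ _ _ => by positivity
    norm_num [catalan_zero] at key ⊢
    nlinarith

theorem summable_catalan_div : Summable fun n => (catalan n : ℝ) / 4 ^ n :=
  summable_of_sum_range_le (fun _ => by positivity) sum_range_catalan_div_le

theorem tsum_catalan_div_le : ∑' n, (catalan n : ℝ) / 4 ^ n ≤ 2 :=
  Real.tsum_le_of_sum_range_le (fun _ => by positivity) sum_range_catalan_div_le

variable {X : Type*} [NormedAddCommGroup X] [InnerProductSpace ℝ X]

/-- Adding ⟨S(1-S)x, (1-S)x⟩ ≥ 0 and ⟨(1-S)Sx, Sx⟩ ≥ 0 leaves ‖Sx‖² ≤ ⟨Sx, x⟩. -/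
theorem norm_le_one_of_isPositive {S : X →L[ℝ] X} (hS : S.IsPositive) (hS' : (1 - S).IsPositive) :
    ‖S‖ ≤ 1 := by
  refine S.opNorm_le_bound zero_le_one fun x => ?_
  have h1 := hS.inner_nonneg_left ((1 - S) x)
  have h2 := hS'.inner_nonneg_left (S x)
  have h3 := hS.inner_left_eq_inner_right x (S x)
  have h4 := hS.inner_left_eq_inner_right (S x) x
  have h5 := real_inner_le_norm (S x) x
  have h6 := hS.inner_left_eq_inner_right (S x) (S x)
  simp only [_root_.sub_apply, one_apply_eq_self, map_sub,
    inner_sub_left, inner_sub_right] at h1 h2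
  have h7 : ‖S x‖ * ‖S x‖ ≤ ‖S x‖ * ‖x‖ := by
    rw [← real_inner_self_eq_norm_mul_norm]
    linarith
  rcases (norm_nonneg (S x)).eq_or_lt with h | h
  · rw [← h]; positivity
  · rw [one_mul]; exact le_of_mul_le_mul_left h7 h

variable [CompleteSpace X]

/-- A positive contraction has a positive square root. -/
theorem exists_sqrt_of_contraction {A : X →L[ℝ] X} (hA : A.IsPositive) (hn : ‖A‖ ≤ 1) :
    ∃ R : X →L[ℝ] X, R.IsPositive ∧ R * R = A := by
  have le_norm : ∀ (T : X →L[ℝ] X) (x : X), inner ℝ (T x) x ≤ ‖T‖ * (‖x‖ * ‖x‖) := fun T x =>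
    (real_inner_le_norm _ _).trans (by
      rw [← mul_assoc]; exact mul_le_mul_of_nonneg_right (T.le_opNorm x) (norm_nonneg _))
  set S : X →L[ℝ] X := 1 - A with hS
  have hSp : S.IsPositive := by
    rw [ContinuousLinearMap.isPositive_def']
    refine ⟨(IsSelfAdjoint.one _).sub hA.isSelfAdjoint, fun x => ?_⟩
    have := le_norm A x
    have h2 : ‖A‖ * (‖x‖ * ‖x‖) ≤ 1 * (‖x‖ * ‖x‖) := by gcongr
    simp only [ContinuousLinearMap.reApplyInnerSelf_apply, hS, _root_.sub_apply,
      one_apply_eq_self, inner_sub_left, real_inner_self_eq_norm_mul_norm, RCLike.re_to_real]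
    linarith
  have hS1 : ‖S‖ ≤ 1 := norm_le_one_of_isPositive hSp (by simpa [hS] using hA)
  set a : ℕ → ℝ := fun n => (catalan n : ℝ) / 4 ^ n with ha
  have ha0 : ∀ n, 0 ≤ a n := fun n => by positivity
  have hpow : ∀ n, ‖S ^ n‖ ≤ 1 := fun n => by
    rcases Nat.eq_zero_or_pos n with rfl | hn
    · rw [pow_zero]; exact ContinuousLinearMap.norm_id_le
    · exact (norm_pow_le' S hn).trans (pow_le_one₀ (norm_nonneg _) hS1)
  have hbd : ∀ n, ‖a n • S ^ n‖ ≤ a n := fun n => by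
    rw [norm_smul, Real.norm_of_nonneg (ha0 n)]
    exact mul_le_of_le_one_right (ha0 n) (hpow n)
  have hsn : Summable fun n => ‖a n • S ^ n‖ :=
    Summable.of_nonneg_of_le (fun _ => norm_nonneg _) hbd summable_catalan_div
  have hs : Summable fun n => a n • S ^ n := hsn.of_norm
  -- `D` is the Catalan generating function at S/4, formally 2(1 - √(1-S))/S; hence 1 - SD/2 is the
  -- candidate for √(1-S) = √A.
  set D : X →L[ℝ] X := ∑' n, a n • S ^ n with hD
  have hD2 : ‖D‖ ≤ 2 := (norm_tsum_le_tsum_norm hsn).trans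
    ((hsn.tsum_le_tsum hbd summable_catalan_div).trans tsum_catalan_div_le)
  have hcomm : Commute S D := Commute.tsum_right _ fun n =>
    ((Commute.refl S).pow_right n).smul_right (a n)
  have hDD : S * (D * D) = (4 : ℝ) • (D - 1) := by
    have h1 : D * D = ∑' n, (4 * a (n + 1)) • S ^ n := by
      rw [hD, tsum_mul_tsum_eq_tsum_sum_antidiagonal_of_summable_norm hsn hsn]
      refine tsum_congr fun n => ?_
      have h4 : 4 * a (n + 1) = ∑ ij ∈ Finset.HasAntidiagonal.antidiagonal n, a ij.1 * a ij.2 := by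
        have := catalan_succ_div_pow n
        simp only [ha]
        linarith
      rw [h4, Finset.sum_smul]
      refine Finset.sum_congr rfl fun ij hij => ?_
      rw [smul_mul_smul_comm, ← pow_add, Finset.HasAntidiagonal.mem_antidiagonal.1 hij]
    have hs1 : Summable fun n => (4 * a (n + 1)) • S ^ n := by
      refine Summable.of_norm_bounded (g := fun n => 4 * a (n + 1))
        (((summable_nat_add_iff 1).2 summable_catalan_div).mul_left 4) fun n => ?_
      rw [norm_smul, Real.norm_of_nonneg (by have := ha0 (n+1); positivity)]
      exact mul_le_of_le_one_right (by have := ha0 (n + 1); positivity) (hpow n)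
    rw [h1, ← hs1.tsum_mul_left, hD, hs.tsum_eq_zero_add]
    have : a 0 • S ^ 0 = 1 := by simp [ha]
    rw [this, add_sub_cancel_left, ← ((summable_nat_add_iff 1).2 hs).tsum_const_smul (4 : ℝ)]
    refine tsum_congr fun n => ?_
    rw [mul_smul_comm, ← pow_succ', mul_smul]
  have hDsa : IsSelfAdjoint D := by
    rw [IsSelfAdjoint, hD, tsum_star]
    refine tsum_congr fun n => ?_
    rw [star_smul, star_pow, hSp.isSelfAdjoint.star_eq, star_trivial]
  refine ⟨1 - (1 / 2 : ℝ) • (S * D), ?_, ?_⟩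
  · rw [ContinuousLinearMap.isPositive_def']
    constructor
    · refine (IsSelfAdjoint.one _).sub (IsSelfAdjoint.smul (IsSelfAdjoint.all _) ?_)
      rw [IsSelfAdjoint, star_mul, hDsa.star_eq, hSp.isSelfAdjoint.star_eq, hcomm.eq]
    -- The Catalan sum being at most 2 gives ‖SD‖ ≤ 2, which is exactly what nonnegativity of 1 -
    -- SD/2 requires.
    · intro x
      have h1 := le_norm (S * D) x
      have h2 : ‖S * D‖ ≤ 2 := (norm_mul_le _ _).trans (by nlinarith [norm_nonneg S, norm_nonneg D])
      have h3 : ‖S * D‖ * (‖x‖ * ‖x‖) ≤ 2 * (‖x‖ * ‖x‖) := by gcongr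
      simp only [ContinuousLinearMap.reApplyInnerSelf_apply, _root_.sub_apply,
        one_apply_eq_self, inner_sub_left, real_inner_self_eq_norm_mul_norm,
        RCLike.re_to_real, _root_.smul_apply, real_inner_smul_left]
      linarith
  · have h1 : (S * D) * (S * D) = S * (S * (D * D)) := by
      rw [mul_assoc, ← mul_assoc D S D, ← hcomm.eq, mul_assoc S D D]
    have hA' : A = 1 - S := by simp [hS]
    rw [sub_mul, mul_sub, mul_sub, smul_mul_smul_comm, h1, hDD, hA']
    simp only [mul_one, one_mul, mul_smul_comm, mul_sub, smul_sub, smul_smul]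
    norm_num
    module

/-- A positive bounded operator on a real Hilbert space has a positive square root. -/
theorem exists_sqrt_of_isPositive {A : X →L[ℝ] X} (hA : A.IsPositive) :
    ∃ R : X →L[ℝ] X, R.IsPositive ∧ R * R = A := by
  set k : ℝ := ‖A‖ + 1
  have hk : 0 < k := by positivity
  obtain ⟨R, hR, hRR⟩ := exists_sqrt_of_contraction (A := k⁻¹ • A)
    (hA.smul_of_nonneg (inv_nonneg.2 hk.le)) (by
      rw [norm_smul, norm_inv, Real.norm_of_nonneg hk.le, inv_mul_le_iff₀ hk]
      simp [k])
  refine ⟨√k • R, hR.smul_of_nonneg (Real.sqrt_nonneg _), ?_⟩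
  rw [smul_mul_smul_comm, hRR, Real.mul_self_sqrt hk.le, smul_inv_smul₀ hk.ne']

theorem opSqrt_spec {Q : X → X} {A : X →L[ℝ] X} (hQ : ∀ x, A x = Q x) (hA : A.IsPositive) :
    (opSqrt Q).IsPositive ∧ opSqrt Q * opSqrt Q = A := by
  have h : ∃ R : X →L[ℝ] X, R.IsPositive ∧ ∀ x, R (R x) = Q x := by
    obtain ⟨R, hR, hRR⟩ := exists_sqrt_of_isPositive hA
    exact ⟨R, hR, fun x => by rw [← hQ, ← hRR]; rfl⟩
  have h' : opSqrt Q = h.choose := dif_pos h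
  rw [h']
  refine ⟨h.choose_spec.1, ?_⟩
  ext x
  rw [hQ]
  exact h.choose_spec.2 x

end Sqrt

/-! ### Isonormal Gaussian processes -/

section WhiteNoise

variable {Ω : Type*} {mΩ : MeasurableSpace Ω} {P : Measure Ω}

theorem L2_inner_eq_integral (u v : Lp ℝ 2 P) : inner ℝ u v = ∫ ω, u ω * v ω ∂P := by
  rw [L2.inner_def]
  exact integral_congr_ae (Filter.Eventually.of_forall fun ω => by simp [mul_comm])

theorem charFun_map_L2 (u : Lp ℝ 2 P) (t : ℝ) :
    charFun (P.map u) t = ∫ ω, Complex.exp (((t • u : Lp ℝ 2 P) ω : ℂ) * Complex.I) ∂P := by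
  rw [charFun_apply_real, integral_map (Lp.aestronglyMeasurable u).aemeasurable (by fun_prop)]
  refine integral_congr_ae ?_
  filter_upwards [Lp.coeFn_smul t u] with ω hω
  rw [hω]
  simp

theorem coeFn_sum_Lp {E ι : Type*} [NormedAddCommGroup E] {p : ENNReal} (s : Finset ι)
    (f : ι → Lp E p P) : ⇑(∑ i ∈ s, f i) =ᵐ[P] fun ω => ∑ i ∈ s, f i ω := by
  classical
  induction s using Finset.induction_on with
  | empty => simp only [Finset.sum_empty]; exact Lp.coeFn_zero E p P
  | insert i s hi ih =>
    rw [Finset.sum_insert hi]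
    filter_upwards [Lp.coeFn_add (f i) (∑ i ∈ s, f i), ih] with ω h1 h2
    rw [h1, Pi.add_apply, h2, Finset.sum_insert hi]

variable [IsProbabilityMeasure P]

theorem integral_abs_le_norm_L2 (u : Lp ℝ 2 P) : ∫ ω, |u ω| ∂P ≤ ‖u‖ := by
  have h1 : eLpNorm u 1 P ≤ eLpNorm u 2 P :=
    eLpNorm_le_eLpNorm_of_exponent_le (by norm_num) (Lp.aestronglyMeasurable u)
  have h2 : ∫ ω, |u ω| ∂P = (eLpNorm u 1 P).toReal := by
    rw [eLpNorm_one_eq_lintegral_enorm, ← integral_norm_eq_lintegral_enorm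
      (Lp.aestronglyMeasurable u)]
    rfl
  rw [h2, Lp.norm_def]
  exact ENNReal.toReal_mono (Lp.eLpNorm_ne_top u) h1

theorem integrable_cexp_L2 (u : Lp ℝ 2 P) :
    Integrable (fun ω => Complex.exp ((u ω : ℂ) * Complex.I)) P := by
  refine Integrable.of_bound (C := 1) ?_ (Filter.Eventually.of_forall fun ω => ?_)
  · exact (by fun_prop : Continuous fun x : ℝ => Complex.exp ((x : ℂ) * Complex.I))
      |>.comp_aestronglyMeasurable (Lp.aestronglyMeasurable u)
  · rw [Complex.norm_exp_ofReal_mul_I]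

/-- The functional is 1-Lipschitz, because |e^{ix} - 1| ≤ |x| and the L¹ norm is at most the L²
norm. It lets Gaussian laws pass to L² limits. -/
theorem continuous_integral_cexp_L2 :
    Continuous fun u : Lp ℝ 2 P => ∫ ω, Complex.exp ((u ω : ℂ) * Complex.I) ∂P := by
  refine LipschitzWith.continuous (K := 1) (LipschitzWith.of_dist_le_mul fun u v => ?_)
  rw [NNReal.coe_one, one_mul, dist_eq_norm, dist_eq_norm,
    ← integral_sub (integrable_cexp_L2 u) (integrable_cexp_L2 v)]
  refine (norm_integral_le_integral_norm _).trans (le_trans ?_ (integral_abs_le_norm_L2 (u - v)))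
  refine integral_mono_ae ((integrable_cexp_L2 u).sub (integrable_cexp_L2 v)).norm
    ((Lp.memLp (u - v)).integrable (by norm_num)).abs ?_
  filter_upwards [Lp.coeFn_sub u v] with ω hω
  have h : Complex.exp ((u ω : ℂ) * Complex.I) - Complex.exp ((v ω : ℂ) * Complex.I) =
      Complex.exp ((v ω : ℂ) * Complex.I) *
        (Complex.exp (Complex.I * ((u ω - v ω : ℝ) : ℂ)) - 1) := by
    rw [mul_sub, ← Complex.exp_add, mul_one]
    congr 2
    push_cast
    ring
  rw [h, norm_mul, Complex.norm_exp_ofReal_mul_I, one_mul, hω]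
  exact Real.norm_exp_I_mul_ofReal_sub_one_le

variable {X : Type*} [NormedAddCommGroup X] [InnerProductSpace ℝ X]

/-- `W` is an isonormal Gaussian process on `X`. -/
def IsIsonormal (W : X →ₗᵢ[ℝ] Lp ℝ 2 P) : Prop :=
  ∀ h : X, P.map (W h) = gaussianReal 0 (‖h‖₊ ^ 2)

/-- A linear isometry into `L²` is isonormal if it is so on a dense subspace. -/
theorem isIsonormal_of_dense {W : X →ₗᵢ[ℝ] Lp ℝ 2 P} (S : Submodule ℝ X)
    (hS : Dense (S : Set X)) (h : ∀ x ∈ S, P.map (W x) = gaussianReal 0 (‖x‖₊ ^ 2)) :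
    IsIsonormal W := by
  have key : (fun x : X => ∫ ω, Complex.exp ((W x ω : ℂ) * Complex.I) ∂P) =
      fun x => Complex.exp (-(‖x‖ : ℂ) ^ 2 / 2) := by
    refine Continuous.ext_on hS (continuous_integral_cexp_L2.comp W.continuous) (by fun_prop) ?_
    intro x hx
    have h1 := charFun_map_L2 (P := P) (W x) 1
    rw [h x hx, charFun_gaussianReal, one_smul] at h1
    simp only
    rw [← h1]
    congr 1
    push_cast
    simp
    ring
  intro x
  have : IsProbabilityMeasure (P.map (W x)) :=
    Measure.isProbabilityMeasure_map (Lp.aestronglyMeasurable (W x)).aemeasurable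
  refine Measure.ext_of_charFun (funext fun t => ?_)
  rw [charFun_map_L2, ← map_smul, charFun_gaussianReal]
  refine (congrFun key (t • x)).trans ?_
  congr 1
  simp only [norm_smul, Complex.ofReal_mul, mul_pow, Real.norm_eq_abs]
  norm_cast
  rw [sq_abs]
  push_cast
  ring_nf

end WhiteNoise

/-- The coordinates of a product of standard Gaussians are orthonormal in L², so sending `b i` to
the i-th coordinate extends to an isometry. Finite combinations are Gaussian by independence, and
their span is dense. -/
theorem exists_isIsonormal {ι : Type*} {X : Type*} [NormedAddCommGroup X] [InnerProductSpace ℝ X]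
    (b : HilbertBasis ι ℝ X) :
    ∃ W : X →ₗᵢ[ℝ] Lp ℝ 2 (Measure.infinitePi fun _ : ι => gaussianReal 0 1), IsIsonormal W := by
  classical
  set P := Measure.infinitePi fun _ : ι => gaussianReal 0 1
  have hlaw : ∀ i, P.map (fun ω => ω i) = gaussianReal 0 1 := fun i =>
    Measure.infinitePi_map_eval _ i
  have hmeas : ∀ i, Measurable fun ω : ι → ℝ => ω i := fun i => measurable_pi_apply i
  have hindep : iIndepFun (fun (i : ι) (ω : ι → ℝ) => ω i) P :=
    iIndepFun_infinitePi (X := fun _ x => x) fun _ => measurable_id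
  have hG : ∀ i, HasGaussianLaw (fun ω : ι → ℝ => ω i) P := fun i => ⟨by
    rw [hlaw i]; infer_instance⟩
  have hmem : ∀ i, MemLp (fun ω : ι → ℝ => ω i) 2 P := fun i => (hG i).memLp_two
  have hmean : ∀ i, ∫ ω : ι → ℝ, ω i ∂P = 0 := fun i => by
    have := integral_map (μ := P) (φ := fun ω : ι → ℝ => ω i) (f := fun x : ℝ => x)
      (hmeas i).aemeasurable (by fun_prop)
    rw [← this, hlaw i]
    simp
  have hvar : ∀ i, ∫ ω : ι → ℝ, ω i * ω i ∂P = 1 := fun i => by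
    have h1 := integral_map (μ := P) (φ := fun ω : ι → ℝ => ω i) (f := fun x : ℝ => x * x)
      (hmeas i).aemeasurable (by fun_prop)
    rw [← h1, hlaw i]
    have h2 := variance_id_gaussianReal (μ := 0) (v := 1)
    rw [variance_eq_integral (by fun_prop)] at h2
    simpa [sq] using h2
  let ξ : ι → Lp ℝ 2 P := fun i => (hmem i).toLp _
  have hξ : ∀ i, ξ i =ᵐ[P] fun ω => ω i := fun i => (hmem i).coeFn_toLp
  have hon : Orthonormal ℝ ξ := by
    rw [orthonormal_iff_ite]
    intro i j
    have h1 : inner ℝ (ξ i) (ξ j) = ∫ ω : ι → ℝ, ω i * ω j ∂P := by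
      rw [L2_inner_eq_integral]
      refine integral_congr_ae ?_
      filter_upwards [hξ i, hξ j] with ω h1 h2
      rw [h1, h2]
    rw [h1]
    split_ifs with hij
    · subst hij; exact hvar i
    · rw [(hindep.indepFun hij).integral_fun_mul_eq_mul_integral
        (hmeas i).aestronglyMeasurable (hmeas j).aestronglyMeasurable, hmean,
        zero_mul]
  have hO := hon.orthogonalFamily
  let W : X →ₗᵢ[ℝ] Lp ℝ 2 P := hO.linearIsometry.comp b.repr.toLinearIsometry
  have hWb : ∀ i, W (b i) = ξ i := fun i => by
    change hO.linearIsometry (b.repr (b i)) = ξ i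
    rw [b.repr_self, hO.linearIsometry_apply_single]
    simp
  refine ⟨W, isIsonormal_of_dense (Submodule.span ℝ (range b))
    ((Submodule.dense_iff_topologicalClosure_eq_top).2 b.dense_span) fun x hx => ?_⟩
  obtain ⟨c, rfl⟩ := (Finsupp.mem_span_range_iff_exists_finsupp).1 hx
  set x := c.sum fun i a => a • b i with hxdef
  have hWx : W x =ᵐ[P] fun ω => ∑ i : c.support, c i * ω i := by
    have h1 : W x = ∑ i ∈ c.support, c i • ξ i := by
      simp only [hxdef, Finsupp.sum, map_sum, map_smul, hWb]
    have h2 : ∀ᵐ ω ∂P, ∀ i ∈ c.support, (c i • ξ i : Lp ℝ 2 P) ω = c i * ω i := by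
      rw [Finset.eventually_all]
      intro i _
      filter_upwards [hξ i, Lp.coeFn_smul (c i) (ξ i)] with ω h3 h4
      rw [h4, Pi.smul_apply, h3, smul_eq_mul]
    rw [h1]
    filter_upwards [h2, coeFn_sum_Lp c.support fun i => c i • ξ i] with ω h3 h4
    rw [h4, Finset.sum_congr rfl h3, ← Finset.sum_coe_sort]
  have hgl : HasGaussianLaw (W x) P := by
    refine HasGaussianLaw.congr ?_ hWx.symm
    refine iIndepFun.hasGaussianLaw_fun_sum (X := fun (i : c.support) (ω : ι → ℝ) => c i * ω i)
      (fun i => (hG i).fun_smul (c i)) ?_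
    exact (hindep.precomp (g := fun i : c.support => (i : ι)) Subtype.val_injective).comp
      (fun i x => c i * x) fun i => by fun_prop
  have hm : ∫ ω, W x ω ∂P = 0 := by
    rw [integral_congr_ae hWx, integral_finsetSum _ fun (i : c.support) _ =>
      ((hmem i).integrable (by norm_num)).const_mul (c i)]
    simp [integral_const_mul, hmean]
  have hv : Var[W x; P] = ‖x‖ ^ 2 := by
    rw [variance_eq_integral (Lp.aestronglyMeasurable _).aemeasurable, hm, ← W.norm_map,
      ← real_inner_self_eq_norm_sq, L2_inner_eq_integral]
    simp [sq]
  rw [hgl.map_eq_gaussianReal, hm, hv]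
  congr 1
  ext
  simp

/-! ### Gaussian vectors as images of white noise, and the Cameron–Martin formula -/

section Isonormal

variable {Ω : Type*} {mΩ : MeasurableSpace Ω} {P : Measure Ω}
variable {X : Type*} [NormedAddCommGroup X] [InnerProductSpace ℝ X]
variable {W : X →ₗᵢ[ℝ] Lp ℝ 2 P}

theorem aemeasurable_Lp {E : Type*} [NormedAddCommGroup E] [MeasurableSpace E] [BorelSpace E]
    (Y : Lp E 2 P) : AEMeasurable Y P :=
  (Lp.aestronglyMeasurable Y).aemeasurable

theorem IsIsonormal.mgf_eq (hW : IsIsonormal W) (h : X) (t : ℝ) :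
    mgf (W h) P t = Real.exp (‖h‖ ^ 2 * t ^ 2 / 2) := by
  rw [mgf_gaussianReal (hW h)]
  simp

theorem coeFn_map_add_smul (a b : X) (u : ℝ) :
    W (a + u • b) =ᵐ[P] fun ω => W a ω + u * W b ω := by
  rw [map_add, map_smul]
  filter_upwards [Lp.coeFn_add (W a) (u • W b), Lp.coeFn_smul u (W b)] with ω h1 h2
  rw [h1, Pi.add_apply, h2, Pi.smul_apply, smul_eq_mul]

/-- Multiplication by a unit vector as an isometry from real-valued to vector-valued `L²`. -/
def smulIsometry (P : Measure Ω) (e : X) (he : ‖e‖ = 1) : Lp ℝ 2 P →ₗᵢ[ℝ] Lp X 2 P where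
  toLinearMap := ((ContinuousLinearMap.toSpanSingleton ℝ e).compLpL 2 P : Lp ℝ 2 P →ₗ[ℝ] Lp X 2 P)
  norm_map' u := by
    rw [Lp.norm_def, Lp.norm_def]
    congr 1
    refine eLpNorm_congr_norm_ae ?_
    filter_upwards [(ContinuousLinearMap.toSpanSingleton ℝ e).coeFn_compLpL (p := 2) u] with ω hω
    erw [hω]
    simp [norm_smul, he]

theorem coeFn_smulIsometry (e : X) (he : ‖e‖ = 1) (u : Lp ℝ 2 P) :
    smulIsometry P e he u =ᵐ[P] fun ω => u ω • e := by
  filter_upwards [(ContinuousLinearMap.toSpanSingleton ℝ e).coeFn_compLpL (p := 2) u] with ω hω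
  exact hω

theorem integrable_Lp_two [IsProbabilityMeasure P] {E : Type*} [NormedAddCommGroup E]
    (Y : Lp E 2 P) : Integrable Y P :=
  (Lp.memLp Y).integrable (by norm_num)

theorem IsIsonormal.integral_eq_zero (hW : IsIsonormal W) (h : X) : ∫ ω, W h ω ∂P = 0 := by
  have := integral_map (aemeasurable_Lp (W h)) (f := fun x : ℝ => x) (by fun_prop)
  rw [← this, hW h]
  simp

theorem IsIsonormal.integrable_exp [IsProbabilityMeasure P] (hW : IsIsonormal W) (h : X) :
    Integrable (fun ω => Real.exp (W h ω)) P := by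
  have h1 : 0 < mgf (W h) P 1 := by rw [hW.mgf_eq]; positivity
  have h2 := mgf_pos_iff.1 h1
  simpa using h2

theorem IsIsonormal.integral_exp (hW : IsIsonormal W) (h : X) :
    ∫ ω, Real.exp (W h ω) ∂P = Real.exp (‖h‖ ^ 2 / 2) := by
  have := hW.mgf_eq h 1
  simpa [mgf] using this

/-- A random variable with the moment generating function of a real Gaussian is Gaussian. -/
theorem map_eq_gaussianReal_of_mgf [IsProbabilityMeasure P] {Z : Ω → ℝ}
    (hZ : AEMeasurable Z P) {m : ℝ} {v : NNReal}
    (h : mgf Z P = mgf id (gaussianReal m v)) : P.map Z = gaussianReal m v := by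
  have hset : integrableExpSet Z P = univ := by
    rw [integrableExpSet_eq_of_mgf h]
    exact integrableExpSet_id_gaussianReal
  rw [← Measure.map_id (μ := gaussianReal m v)]
  refine Measure.ext_of_complexMGF_eq hZ aemeasurable_id (funext fun z => ?_)
  exact eqOn_complexMGF_of_mgf h (by simp [hset])

theorem IsIsonormal.isProbabilityMeasure_tilted [IsProbabilityMeasure P]
    (hW : IsIsonormal W) (a : X) :
    IsProbabilityMeasure (P.tilted (W a)) :=
  MeasureTheory.isProbabilityMeasure_tilted (hW.integrable_exp a)

/-- Under the exponentially tilted measure, `W` is shifted. -/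
theorem IsIsonormal.map_tilted [IsProbabilityMeasure P] (hW : IsIsonormal W) (a b : X) :
    (P.tilted (W a)).map (W b) = gaussianReal (inner ℝ a b) (‖b‖₊ ^ 2) := by
  have := hW.isProbabilityMeasure_tilted a
  refine map_eq_gaussianReal_of_mgf
    ((aemeasurable_Lp (W b)).mono_ac (tilted_absolutelyContinuous _ _)) (funext fun u => ?_)
  rw [mgf_id_gaussianReal, mgf, integral_exp_tilted, hW.integral_exp]
  have h1 : ∫ ω, Real.exp ((⇑(W a) + fun ω => u * W b ω) ω) ∂P =
      ∫ ω, Real.exp (W (a + u • b) ω) ∂P := by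
    refine integral_congr_ae ?_
    filter_upwards [coeFn_map_add_smul (W := W) a b u] with ω hω
    rw [hω, Pi.add_apply]
  rw [h1, hW.integral_exp, ← Real.exp_sub]
  congr 1
  -- The exponent (‖a + ub‖² - ‖a‖²)/2 equals u⟨a,b⟩ + u²‖b‖²/2: the tilt changes the mean and keeps
  -- the variance.
  rw [norm_add_sq_real, norm_smul, real_inner_smul_right, mul_pow, Real.norm_eq_abs, sq_abs]
  push_cast
  ring

variable [CompleteSpace X]

/-- `Y` is a version of the image under `R` of the white noise `W`. -/
def IsImageOfNoise (W : X →ₗᵢ[ℝ] Lp ℝ 2 P) (R : X →L[ℝ] X) (Y : Lp X 2 P) : Prop :=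
  ∀ y : X, (fun ω => inner ℝ (Y ω) y) =ᵐ[P] W (R y)

/-- The vector is Y = Σ W(R bᵢ) bᵢ. Its terms lie in mutually orthogonal copies of real L², so
convergence is precisely the Hilbert–Schmidt condition on `R`. -/
theorem exists_isImageOfNoise {ι : Type*} (b : HilbertBasis ι ℝ X) {R : X →L[ℝ] X}
    (hR : Summable fun i => ‖R (b i)‖ ^ 2) : ∃ Y : Lp X 2 P, IsImageOfNoise W R Y := by
  let V : ι → (Lp ℝ 2 P →ₗᵢ[ℝ] Lp X 2 P) := fun i => smulIsometry P (b i) (b.orthonormal.1 i)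
  have hV : OrthogonalFamily ℝ (fun _ : ι => Lp ℝ 2 P) V := by
    intro i j hij u v
    rw [L2.inner_def]
    refine integral_eq_zero_of_ae ?_
    filter_upwards [coeFn_smulIsometry (b i) (b.orthonormal.1 i) u,
      coeFn_smulIsometry (b j) (b.orthonormal.1 j) v] with ω h1 h2
    rw [h1, h2, real_inner_smul_left, real_inner_smul_right, b.orthonormal.2 hij]
    simp
  have hs : Summable fun i => V i (W (R (b i))) := by
    rw [hV.summable_iff_norm_sq_summable fun i => W (R (b i))]
    simpa using hR
  refine ⟨∑' i, V i (W (R (b i))), fun y => ?_⟩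
  let T : Lp X 2 P →L[ℝ] Lp ℝ 2 P := (innerSL ℝ y).compLpL 2 P
  have hT : ∀ Z : Lp X 2 P, T Z =ᵐ[P] fun ω => inner ℝ (Z ω) y := fun Z => by
    filter_upwards [(innerSL ℝ y).coeFn_compLpL (p := 2) Z] with ω hω
    rw [real_inner_comm]
    exact hω
  have h1 : HasSum (fun i => T (V i (W (R (b i))))) (T (∑' i, V i (W (R (b i))))) :=
    hs.hasSum.mapL T
  have h2 : ∀ i, T (V i (W (R (b i)))) = W (R (inner ℝ (b i) y • b i)) := fun i => by
    ext1
    rw [map_smul, map_smul]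
    filter_upwards [hT (V i (W (R (b i)))), Lp.coeFn_smul (inner ℝ (b i) y) (W (R (b i))),
      coeFn_smulIsometry (b i) (b.orthonormal.1 i) (W (R (b i)))] with ω h1 h2 h3
    rw [h1, h2, h3, real_inner_smul_left]
    simp [mul_comm]
  have h3 : HasSum (fun i => W (R (inner ℝ (b i) y • b i))) (W (R y)) := by
    have := b.hasSum_repr y
    simp_rw [b.repr_apply_apply] at this
    exact (this.mapL R).mapL W.toContinuousLinearMap
  simp_rw [h2] at h1
  rw [← h1.unique h3]
  exact (hT _).symm

variable {R : X →L[ℝ] X} {Y : Lp X 2 P}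

theorem IsImageOfNoise.integral_eq_zero [IsProbabilityMeasure P]
    (hY : IsImageOfNoise W R Y) (hW : IsIsonormal W) :
    ∫ ω, Y ω ∂P = 0 := by
  refine integral_eq_zero_of_forall_integral_inner_eq_zero ℝ _ (integrable_Lp_two Y) fun c => ?_
  rw [← hW.integral_eq_zero (R c)]
  refine integral_congr_ae ?_
  filter_upwards [hY c] with ω hω
  rw [← hω, real_inner_comm]

variable [TopologicalSpace.SeparableSpace X] [MeasurableSpace X] [BorelSpace X]

theorem IsImageOfNoise.isGaussian (hY : IsImageOfNoise W R Y) (hW : IsIsonormal W) (m : X) :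
    IsGaussian (P.map fun ω => m + Y ω) := by
  have : SecondCountableTopology X := UniformSpace.secondCountable_of_separable X
  refine isGaussian_of_map_eq_gaussianReal fun L => ?_
  obtain ⟨y, rfl⟩ := (InnerProductSpace.toDual ℝ X).surjective L
  refine ⟨inner ℝ y m, ‖R y‖₊ ^ 2, ?_⟩
  rw [AEMeasurable.map_map_of_aemeasurable (by fun_prop)
    ((aemeasurable_Lp Y).const_add m)]
  have h1 : (⇑((InnerProductSpace.toDual ℝ X) y) ∘ fun ω => m + Y ω) =ᵐ[P]
      fun ω => inner ℝ y m + W (R y) ω := by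
    filter_upwards [hY y] with ω hω
    simp only [Function.comp_apply, InnerProductSpace.toDual_apply_apply, inner_add_right, ← hω,
      real_inner_comm]
  rw [Measure.map_congr h1]
  have h2 := (gaussianReal_const_add ⟨aemeasurable_Lp (W (R y)), hW (R y)⟩ (inner ℝ y m)).map_eq
  rwa [zero_add] at h2

theorem IsImageOfNoise.isGaussianMeasureWith [IsProbabilityMeasure P]
    (hY : IsImageOfNoise W R Y) (hW : IsIsonormal W)
    (hR : R.IsPositive) {Q : X → X} (hQ : ∀ x, R (R x) = Q x) (m : X) :
    IsGaussianMeasureWith m Q (P.map fun ω => m + Y ω) := by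
  have : SecondCountableTopology X := UniformSpace.secondCountable_of_separable X
  have hmeas : AEMeasurable (fun ω => m + Y ω) P := (aemeasurable_Lp Y).const_add m
  have hG := hY.isGaussian hW m
  have hmean : ∫ y, y ∂(P.map fun ω => m + Y ω) = m := by
    rw [integral_map hmeas (by fun_prop), integral_add (integrable_const _) (integrable_Lp_two Y),
      hY.integral_eq_zero hW]
    simp
  refine ⟨hG, hmean, fun y z => ?_⟩
  rw [covarianceBilin_apply IsGaussian.memLp_two_id]
  simp only [id_eq, hmean]
  rw [integral_map hmeas (by fun_prop), ← hQ, hR.inner_left_eq_inner_right, ← W.inner_map_map,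
    L2_inner_eq_integral]
  refine integral_congr_ae ?_
  filter_upwards [hY y, hY z] with ω h1 h2
  rw [← h1, ← h2, add_sub_cancel_left, real_inner_comm y, real_inner_comm z]

theorem IsGaussianMeasureWith.unique {m : X} {Q : X → X} {μ ν : Measure X}
    (hμ : IsGaussianMeasureWith m Q μ) (hν : IsGaussianMeasureWith m Q ν) : μ = ν := by
  have : SecondCountableTopology X := UniformSpace.secondCountable_of_separable X
  have := hμ.1
  have := hν.1
  refine IsGaussian.ext (hμ.2.1.trans hν.2.1.symm) ?_
  ext y z
  rw [hμ.2.2, hν.2.2]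

/-- `gaussianMeasure` is defined by choice; uniqueness of a Gaussian law with given mean and
covariance replaces it by this concrete one. -/
theorem IsImageOfNoise.gaussianMeasure_eq [IsProbabilityMeasure P]
    (hY : IsImageOfNoise W R Y) (hW : IsIsonormal W)
    (hR : R.IsPositive) {Q : X → X} (hQ : ∀ x, R (R x) = Q x) (m : X) :
    gaussianMeasure m Q = P.map fun ω => m + Y ω := by
  have h : ∃ μ : Measure X, IsGaussianMeasureWith m Q μ :=
    ⟨_, hY.isGaussianMeasureWith hW hR hQ m⟩
  have h' : gaussianMeasure m Q = h.choose := dif_pos h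
  rw [h']
  exact h.choose_spec.unique (hY.isGaussianMeasureWith hW hR hQ m)

/-- The Cameron–Martin formula. -/
theorem IsImageOfNoise.map_add_eq [IsProbabilityMeasure P]
    (hY : IsImageOfNoise W R Y) (hW : IsIsonormal W)
    (hR : R.IsPositive) (a : X) :
    P.map (fun ω => R a + Y ω) = (P.tilted (W a)).map Y := by
  have : SecondCountableTopology X := UniformSpace.secondCountable_of_separable X
  have := hW.isProbabilityMeasure_tilted a
  have hac := tilted_absolutelyContinuous P (W a)
  have hm1 : AEMeasurable (fun ω => R a + Y ω) P := (aemeasurable_Lp Y).const_add _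
  have hm2 : AEMeasurable Y (P.tilted (W a)) := (aemeasurable_Lp Y).mono_ac hac
  have := Measure.isProbabilityMeasure_map hm1
  have := Measure.isProbabilityMeasure_map hm2
  refine Measure.ext_of_charFun (funext fun y => ?_)
  -- On one side the shift yields the phase ⟨Ra, y⟩, on the other the tilt gives W(Ry) the mean ⟨a,
  -- Ry⟩; they agree because `R` is symmetric.
  rw [charFun_apply, charFun_apply, integral_map hm1 (by fun_prop), integral_map hm2 (by fun_prop)]
  have h1 : ∫ ω, Complex.exp ((inner ℝ (R a + Y ω) y : ℝ) * Complex.I) ∂P =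
      Complex.exp ((inner ℝ (R a) y : ℝ) * Complex.I) * charFun (P.map (W (R y))) 1 := by
    rw [charFun_apply_real, integral_map (aemeasurable_Lp _) (by fun_prop), ← integral_const_mul]
    refine integral_congr_ae ?_
    filter_upwards [hY y] with ω hω
    rw [inner_add_left, hω, ← Complex.exp_add]
    push_cast
    ring_nf
  have h2 : ∫ ω, Complex.exp ((inner ℝ (Y ω) y : ℝ) * Complex.I) ∂(P.tilted (W a)) =
      charFun ((P.tilted (W a)).map (W (R y))) 1 := by
    rw [charFun_apply_real, integral_map ((aemeasurable_Lp _).mono_ac hac) (by fun_prop)]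
    refine integral_congr_ae ?_
    filter_upwards [hac.ae_eq (hY y)] with ω hω
    rw [hω]
    simp
  rw [h1, h2, hW (R y), hW.map_tilted, charFun_gaussianReal, charFun_gaussianReal,
    hR.inner_left_eq_inner_right, ← Complex.exp_add]
  congr 1
  push_cast
  ring

/-- This is the source of all smoothness: ψ is only measurable, while the weight is analytic in `a`.
-/
theorem IsImageOfNoise.integral_shift_eq [IsProbabilityMeasure P]
    (hY : IsImageOfNoise W R Y) (hW : IsIsonormal W)
    (hR : R.IsPositive) (a : X) {ψ : X → ℝ} (hψ : Measurable ψ) :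
    ∫ ω, ψ (R a + Y ω) ∂P =
      Real.exp (-(‖a‖ ^ 2 / 2)) * ∫ ω, ψ (Y ω) * Real.exp (W a ω) ∂P := by
  have : SecondCountableTopology X := UniformSpace.secondCountable_of_separable X
  have hac := tilted_absolutelyContinuous P (W a)
  have h1 := integral_map (μ := P) ((aemeasurable_Lp Y).const_add (R a)) (f := ψ)
    hψ.aestronglyMeasurable
  rw [← h1, hY.map_add_eq hW hR, integral_map ((aemeasurable_Lp Y).mono_ac hac)
    hψ.aestronglyMeasurable, integral_tilted, hW.integral_exp, ← integral_const_mul]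
  refine integral_congr_ae (Filter.Eventually.of_forall fun ω => ?_)
  simp only [smul_eq_mul, Real.exp_neg]
  ring

end Isonormal

/-- The product is at most the n-th power of its largest factor, and xⁿ ≤ n! eˣ. The summand 1
covers the empty product, and the n! later cancels the one in the exponential series. -/
theorem prod_le_factorial_mul_exp {n : ℕ} (x : Fin n → ℝ) (hx : ∀ i, 0 ≤ x i) :
    ∏ i, x i ≤ n.factorial * (1 + ∑ i, Real.exp (x i)) := by
  rcases Nat.eq_zero_or_pos n with rfl | hn
  · simp
  · have : Nonempty (Fin n) := ⟨⟨0, hn⟩⟩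
    obtain ⟨j, -, hj⟩ := Finset.exists_max_image Finset.univ x Finset.univ_nonempty
    have hf : (0 : ℝ) < n.factorial := by positivity
    calc ∏ i, x i ≤ ∏ _i : Fin n, x j := Finset.prod_le_prod (fun i _ => hx i) hj
      _ = x j ^ n := by simp
      _ ≤ n.factorial * Real.exp (x j) := by
        have := Real.pow_div_factorial_le_exp (x j) (hx j) n
        rw [div_le_iff₀ hf] at this
        linarith
      _ ≤ n.factorial * (1 + ∑ i, Real.exp (x i)) := by
        gcongr
        have := Finset.single_le_sum (f := fun i => Real.exp (x i)) (fun i _ => (Real.exp_pos _).le)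
          (Finset.mem_univ j)
        linarith

theorem exp_abs_le_add (x : ℝ) : Real.exp |x| ≤ Real.exp x + Real.exp (-x) := by
  rcases abs_cases x with ⟨h, -⟩ | ⟨h, -⟩ <;> rw [h] <;>
    linarith [Real.exp_pos x, Real.exp_pos (-x)]

theorem two_mul_exp_half_le : 2 * Real.exp (1 / 2) ≤ 4 := by
  have h1 : Real.exp (1 / 2) * Real.exp (1 / 2) = Real.exp 1 := by
    rw [← Real.exp_add]; norm_num
  have h2 := Real.exp_one_lt_d9
  nlinarith [Real.exp_pos (1 / 2)]

/-! ### Power series of the exponential weight and derivative bounds -/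

section WickSeries

variable {Ω : Type*} {mΩ : MeasurableSpace Ω} {P : Measure Ω}
variable {X : Type*} [NormedAddCommGroup X] [InnerProductSpace ℝ X]
variable {W : X →ₗᵢ[ℝ] Lp ℝ 2 P}

theorem exp_neg_noise_ae (W : X →ₗᵢ[ℝ] Lp ℝ 2 P) (h : X) :
    (fun ω => Real.exp (-W h ω)) =ᵐ[P] fun ω => Real.exp (W (-h) ω) := by
  rw [map_neg]
  filter_upwards [Lp.coeFn_neg (W h)] with ω hω
  rw [hω, Pi.neg_apply]

theorem aestronglyMeasurable_prod_noise (W : X →ₗᵢ[ℝ] Lp ℝ 2 P) {n : ℕ} (m : Fin n → X) :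
    AEStronglyMeasurable (fun ω => ∏ i, W (m i) ω) P :=
  Finset.aestronglyMeasurable_fun_prod _ fun i _ => Lp.aestronglyMeasurable (W (m i))

theorem prod_noise_update {n : ℕ} (W : X →ₗᵢ[ℝ] Lp ℝ 2 P) [DecidableEq (Fin n)] (m : Fin n → X)
    (i : Fin n) (x : X) (ω : Ω) : ∏ j, W (Function.update m i x j) ω =
      W x ω * ∏ j ∈ Finset.univ \ {i}, W (m j) ω := by
  have := Finset.prod_update_of_mem (Finset.mem_univ i) (fun j => W (m j) ω) (W x ω)
  rw [← this]
  refine Finset.prod_congr rfl fun j _ => ?_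
  rcases eq_or_ne j i with rfl | h
  · simp
  · simp [h]

variable [IsProbabilityMeasure P]

theorem IsIsonormal.integrable_exp_neg (hW : IsIsonormal W) (h : X) :
    Integrable (fun ω => Real.exp (-W h ω)) P :=
  (hW.integrable_exp (-h)).congr (exp_neg_noise_ae W h).symm

theorem IsIsonormal.integrable_exp_abs (hW : IsIsonormal W) (h : X) :
    Integrable (fun ω => Real.exp |W h ω|) P := by
  refine ((hW.integrable_exp h).add (hW.integrable_exp_neg h)).mono' ?_
    (Filter.Eventually.of_forall fun ω => ?_)
  · exact (by fun_prop : Continuous fun x : ℝ => Real.exp |x|).comp_aestronglyMeasurable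
      (Lp.aestronglyMeasurable (W h))
  · rw [Real.norm_of_nonneg (Real.exp_pos _).le]
    exact exp_abs_le_add _

theorem IsIsonormal.integral_exp_abs_le (hW : IsIsonormal W) {h : X} (hh : ‖h‖ ≤ 1) :
    ∫ ω, Real.exp |W h ω| ∂P ≤ 4 := by
  calc ∫ ω, Real.exp |W h ω| ∂P
      ≤ ∫ ω, (Real.exp (W h ω) + Real.exp (-W h ω)) ∂P :=
        integral_mono (hW.integrable_exp_abs h)
          ((hW.integrable_exp h).add (hW.integrable_exp_neg h)) fun ω => exp_abs_le_add _
    _ = 2 * Real.exp (‖h‖ ^ 2 / 2) := by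
        rw [integral_add (hW.integrable_exp h) (hW.integrable_exp_neg h),
          integral_congr_ae (exp_neg_noise_ae W h), hW.integral_exp, hW.integral_exp, norm_neg]
        ring
    _ ≤ 2 * Real.exp (1 / 2) := by
        gcongr
        exact pow_le_one₀ (norm_nonneg _) hh
    _ ≤ 4 := two_mul_exp_half_le

theorem IsIsonormal.integrable_prod (hW : IsIsonormal W) {n : ℕ} (m : Fin n → X) :
    Integrable (fun ω => ∏ i, W (m i) ω) P := by
  refine (((integrable_const (1 : ℝ)).add (integrable_finsetSum Finset.univ
    fun i _ => hW.integrable_exp_abs (m i))).const_mul (n.factorial : ℝ)).mono'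
    (aestronglyMeasurable_prod_noise W m) (Filter.Eventually.of_forall fun ω => ?_)
  rw [Real.norm_eq_abs, Finset.abs_prod]
  exact prod_le_factorial_mul_exp _ fun i => abs_nonneg _

theorem IsIsonormal.integral_abs_prod_le_of_norm_le_one (hW : IsIsonormal W) {n : ℕ}
    (m : Fin n → X) (hm : ∀ i, ‖m i‖ ≤ 1) :
    ∫ ω, |∏ i, W (m i) ω| ∂P ≤ n.factorial * (1 + 4 * n) := by
  have hi := integrable_finsetSum Finset.univ fun i _ => hW.integrable_exp_abs (m i)
  calc ∫ ω, |∏ i, W (m i) ω| ∂P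
      ≤ ∫ ω, n.factorial * (1 + ∑ i, Real.exp |W (m i) ω|) ∂P := by
        refine integral_mono (hW.integrable_prod m).abs
          (((integrable_const (1 : ℝ)).add hi).const_mul _) fun ω => ?_
        simp only [Finset.abs_prod]
        exact prod_le_factorial_mul_exp _ fun i => abs_nonneg _
    _ = n.factorial * (1 + ∑ i, ∫ ω, Real.exp |W (m i) ω| ∂P) := by
        rw [integral_const_mul, integral_add (integrable_const _) hi,
          integral_finsetSum _ fun i _ => hW.integrable_exp_abs (m i)]
        simp
    _ ≤ n.factorial * (1 + ∑ _i : Fin n, 4) := by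
        gcongr with i
        exact hW.integral_exp_abs_le (hm i)
    _ = n.factorial * (1 + 4 * n) := by simp [mul_comm]

theorem IsIsonormal.integral_abs_prod_le (hW : IsIsonormal W) {n : ℕ} (m : Fin n → X) :
    ∫ ω, |∏ i, W (m i) ω| ∂P ≤ n.factorial * (1 + 4 * n) * ∏ i, ‖m i‖ := by
  have h1 := hW.integral_abs_prod_le_of_norm_le_one (fun i => ‖m i‖⁻¹ • m i) fun i => by
    rw [norm_smul, norm_inv, norm_norm]
    exact inv_mul_le_one
  have h2 : (fun ω => |∏ i, W (m i) ω|) =ᵐ[P]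
      fun ω => (∏ i, ‖m i‖) * |∏ i, W (‖m i‖⁻¹ • m i) ω| := by
    have : ∀ᵐ ω ∂P, ∀ i, W (m i) ω = ‖m i‖ * W (‖m i‖⁻¹ • m i) ω := by
      rw [ae_all_iff]
      intro i
      have h3 : W (m i) = ‖m i‖ • W (‖m i‖⁻¹ • m i) := by
        rw [← map_smul]
        congr 1
        -- When `m i = 0` the inverse norm is 0 by convention and both sides vanish.
        rcases eq_or_ne (m i) 0 with h | h
        · simp [h]
        · rw [smul_inv_smul₀ (norm_ne_zero_iff.2 h)]
      have h4 := Lp.coeFn_smul ‖m i‖ (W (‖m i‖⁻¹ • m i))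
      rw [← h3] at h4
      exact h4
    filter_upwards [this] with ω hω
    rw [Finset.prod_congr rfl fun i _ => hω i, Finset.prod_mul_distrib, abs_mul, abs_of_nonneg
      (Finset.prod_nonneg fun i _ => norm_nonneg _)]
  rw [integral_congr_ae h2, integral_const_mul, mul_comm]
  exact mul_le_mul_of_nonneg_right h1 (Finset.prod_nonneg fun i _ => norm_nonneg _)

variable {Ψ : Ω → ℝ} {M : ℝ}

theorem IsIsonormal.integrable_mul_prod (hW : IsIsonormal W) (hΨ : AEStronglyMeasurable Ψ P)
    (hM : ∀ ω, |Ψ ω| ≤ M) {n : ℕ} (m : Fin n → X) :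
    Integrable (fun ω => Ψ ω * ∏ i, W (m i) ω) P :=
  (hW.integrable_prod m).bdd_mul hΨ (Filter.Eventually.of_forall hM)

/-- The multilinear map `m ↦ E[Ψ W(m₁) ⋯ W(mₙ)]`. -/
def noiseMultilinear (hW : IsIsonormal W) (hΨ : AEStronglyMeasurable Ψ P) (hM : ∀ ω, |Ψ ω| ≤ M)
    (n : ℕ) : MultilinearMap ℝ (fun _ : Fin n => X) ℝ where
  toFun m := ∫ ω, Ψ ω * ∏ i, W (m i) ω ∂P
  map_update_add' m i x y := by
    rw [← integral_add (hW.integrable_mul_prod hΨ hM _) (hW.integrable_mul_prod hΨ hM _)]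
    refine integral_congr_ae ?_
    filter_upwards [Lp.coeFn_add (W x) (W y)] with ω h
    rw [prod_noise_update, prod_noise_update, prod_noise_update, map_add, h, Pi.add_apply]
    ring
  map_update_smul' m i c x := by
    rw [smul_eq_mul, ← integral_const_mul]
    refine integral_congr_ae ?_
    filter_upwards [Lp.coeFn_smul c (W x)] with ω h
    rw [prod_noise_update, prod_noise_update, map_smul, h, Pi.smul_apply, smul_eq_mul]
    ring

theorem norm_noiseMultilinear_le (hW : IsIsonormal W) (hΨ : AEStronglyMeasurable Ψ P)
    (hM : ∀ ω, |Ψ ω| ≤ M) (n : ℕ) (m : Fin n → X) :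
    ‖noiseMultilinear hW hΨ hM n m‖ ≤ M * (n.factorial * (1 + 4 * n)) * ∏ i, ‖m i‖ := by
  obtain ⟨ω⟩ := nonempty_of_isProbabilityMeasure P
  have hM0 : 0 ≤ M := (abs_nonneg _).trans (hM ω)
  calc ‖noiseMultilinear hW hΨ hM n m‖
      ≤ ∫ ω, ‖Ψ ω * ∏ i, W (m i) ω‖ ∂P := norm_integral_le_integral_norm _
    _ ≤ ∫ ω, M * |∏ i, W (m i) ω| ∂P := by
        refine integral_mono (hW.integrable_mul_prod hΨ hM m).norm
          ((hW.integrable_prod m).abs.const_mul M) fun ω => ?_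
        simp only [norm_mul, Real.norm_eq_abs]
        exact mul_le_mul_of_nonneg_right (hM ω) (abs_nonneg _)
    _ ≤ M * (n.factorial * (1 + 4 * n) * ∏ i, ‖m i‖) := by
        rw [integral_const_mul]
        exact mul_le_mul_of_nonneg_left (hW.integral_abs_prod_le m) hM0
    _ = _ := by ring

/-- The power series at `0` of `a ↦ E[Ψ exp(W(a))]`. -/
def noiseSeries (hW : IsIsonormal W) (hΨ : AEStronglyMeasurable Ψ P) (hM : ∀ ω, |Ψ ω| ≤ M) :
    FormalMultilinearSeries ℝ X ℝ := fun n =>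
  (n.factorial : ℝ)⁻¹ • (noiseMultilinear hW hΨ hM n).mkContinuous _
    (norm_noiseMultilinear_le hW hΨ hM n)

theorem norm_noiseSeries_apply_le (hW : IsIsonormal W) (hΨ : AEStronglyMeasurable Ψ P)
    (hM : ∀ ω, |Ψ ω| ≤ M) (n : ℕ) (m : Fin n → X) :
    ‖noiseSeries hW hΨ hM n m‖ ≤ M * (1 + 4 * n) * ∏ i, ‖m i‖ := by
  have h := norm_noiseMultilinear_le hW hΨ hM n m
  have hf : (0 : ℝ) < n.factorial := by positivity
  have h1 : noiseSeries hW hΨ hM n m = (n.factorial : ℝ)⁻¹ * noiseMultilinear hW hΨ hM n m := rfl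
  rw [h1, norm_mul, norm_inv, Real.norm_of_nonneg hf.le, inv_mul_le_iff₀ hf]
  refine h.trans (le_of_eq ?_)
  ring

theorem norm_noiseSeries_le (hW : IsIsonormal W) (hΨ : AEStronglyMeasurable Ψ P)
    (hM : ∀ ω, |Ψ ω| ≤ M) (n : ℕ) : ‖noiseSeries hW hΨ hM n‖ ≤ M * (1 + 4 * n) := by
  obtain ⟨ω⟩ := nonempty_of_isProbabilityMeasure P
  have hM0 : 0 ≤ M := (abs_nonneg _).trans (hM ω)
  exact ContinuousMultilinearMap.opNorm_le_bound (by positivity)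
    (norm_noiseSeries_apply_le hW hΨ hM n)

/-- Term-by-term integration is dominated by M exp|W a|, which is integrable for every `a`. -/
theorem hasSum_noiseSeries (hW : IsIsonormal W) (hΨ : AEStronglyMeasurable Ψ P)
    (hM : ∀ ω, |Ψ ω| ≤ M) (a : X) :
    HasSum (fun n => noiseSeries hW hΨ hM n fun _ => a) (∫ ω, Ψ ω * Real.exp (W a ω) ∂P) := by
  have hsum : ∀ x : ℝ, HasSum (fun n : ℕ => x ^ n / n.factorial) (Real.exp x) := fun x => by
    rw [Real.exp_eq_exp_ℝ]
    exact NormedSpace.expSeries_div_hasSum_exp x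
  have h1 : ∀ n, (noiseSeries hW hΨ hM n fun _ => a) =
      ∫ ω, Ψ ω * (W a ω ^ n / n.factorial) ∂P := fun n => by
    have h2 : (noiseSeries hW hΨ hM n fun _ => a) =
      (n.factorial : ℝ)⁻¹ * ∫ ω, Ψ ω * ∏ _i : Fin n, W a ω ∂P := rfl
    rw [h2, ← integral_const_mul]
    refine integral_congr_ae (Filter.Eventually.of_forall fun ω => ?_)
    simp only [Finset.prod_const, Finset.card_univ, Fintype.card_fin]
    ring
  simp_rw [h1]
  have hWm := (Lp.aestronglyMeasurable (W a))
  refine hasSum_integral_of_dominated_convergence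
    (fun n ω => M * (|W a ω| ^ n / n.factorial)) (fun n => ?_)
    (fun n => Filter.Eventually.of_forall fun ω => ?_)
    (Filter.Eventually.of_forall fun ω => ((hsum _).mul_left M).summable) ?_
    (Filter.Eventually.of_forall fun ω => (hsum _).mul_left _)
  · exact hΨ.mul ((by fun_prop : Continuous fun x : ℝ => x ^ n / n.factorial)
      |>.comp_aestronglyMeasurable hWm)
  · rw [norm_mul, norm_div, norm_pow, Real.norm_natCast, Real.norm_eq_abs, Real.norm_eq_abs]
    gcongr
    exact hM ω
  · have h3 : (fun ω => ∑' n : ℕ, M * (|W a ω| ^ n / n.factorial)) =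
        fun ω => M * Real.exp |W a ω| := funext fun ω => ((hsum _).mul_left M).tsum_eq
    rw [h3]
    exact (hW.integrable_exp_abs a).const_mul M

/-- The coefficients grow at most linearly, 1 + 4n ≤ 5·2ⁿ. The radius 1/2 is a convenience: only
derivatives at the centre are used. -/
theorem hasFPowerSeriesOnBall_noise (hW : IsIsonormal W) (hΨ : AEStronglyMeasurable Ψ P)
    (hM : ∀ ω, |Ψ ω| ≤ M) :
    HasFPowerSeriesOnBall (fun a => ∫ ω, Ψ ω * Real.exp (W a ω) ∂P) (noiseSeries hW hΨ hM) 0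
      ((1 / 2 : NNReal) : ENNReal) where
  r_le := by
    obtain ⟨ω⟩ := nonempty_of_isProbabilityMeasure P
    have hM0 : 0 ≤ M := (abs_nonneg _).trans (hM ω)
    refine FormalMultilinearSeries.le_radius_of_bound _ (M * 5) fun n => ?_
    have h1 : (n : ℝ) ≤ 2 ^ n := by exact_mod_cast n.lt_two_pow_self.le
    have h2 : (1 : ℝ) ≤ 2 ^ n := one_le_pow₀ (by norm_num)
    calc ‖noiseSeries hW hΨ hM n‖ * ((1 / 2 : NNReal) : ℝ) ^ n
        ≤ (M * (5 * 2 ^ n)) * (1 / 2) ^ n := by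
          push_cast
          gcongr
          refine (norm_noiseSeries_le hW hΨ hM n).trans ?_
          gcongr
          linarith
      _ = M * 5 := by
          rw [mul_assoc, mul_assoc, ← mul_pow]
          norm_num
  r_pos := by norm_num
  hasSum := fun {a} _ => by
    rw [zero_add]
    exact hasSum_noiseSeries hW hΨ hM a

/-- The n-th derivative at the centre symmetrises the n-th coefficient over n! permutations. -/
theorem norm_iteratedFDeriv_noise_le (hW : IsIsonormal W) (hΨ : AEStronglyMeasurable Ψ P)
    (hM : ∀ ω, |Ψ ω| ≤ M) (n : ℕ) :
    ‖iteratedFDeriv ℝ n (fun a => ∫ ω, Ψ ω * Real.exp (W a ω) ∂P) 0‖ ≤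
      n.factorial * (1 + 4 * n) * M := by
  obtain ⟨ω⟩ := nonempty_of_isProbabilityMeasure P
  have hM0 : 0 ≤ M := (abs_nonneg _).trans (hM ω)
  refine ContinuousMultilinearMap.opNorm_le_bound (by positivity) fun v => ?_
  rw [(hasFPowerSeriesOnBall_noise hW hΨ hM).iteratedFDeriv_eq_sum_of_completeSpace]
  refine (norm_sum_le _ _).trans ?_
  calc ∑ σ : Equiv.Perm (Fin n), ‖noiseSeries hW hΨ hM n fun i => v (σ i)‖
      ≤ ∑ _σ : Equiv.Perm (Fin n), M * (1 + 4 * n) * ∏ i, ‖v i‖ := by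
        refine Finset.sum_le_sum fun σ _ => ?_
        refine (norm_noiseSeries_apply_le hW hΨ hM n _).trans_eq ?_
        rw [Equiv.prod_comp σ fun i => ‖v i‖]
    _ = n.factorial * (1 + 4 * n) * M * ∏ i, ‖v i‖ := by
        rw [Finset.sum_const, Finset.card_univ, Fintype.card_perm, Fintype.card_fin, nsmul_eq_mul]
        ring

/-- The constant in the bound of the `n`-th derivative of a Gaussian convolution. -/
def smoothingConst (X : Type*) [NormedAddCommGroup X] [InnerProductSpace ℝ X] (n : ℕ) : ℝ :=
  ∑ i ∈ Finset.range (n + 1), (n.choose i : ℝ) *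
    ‖iteratedFDeriv ℝ i (fun a : X => Real.exp (-(‖a‖ ^ 2 / 2))) 0‖ *
      ((n - i).factorial * (1 + 4 * (n - i : ℕ)))

theorem smoothingConst_nonneg (n : ℕ) : 0 ≤ smoothingConst X n :=
  Finset.sum_nonneg fun _ _ => by positivity

theorem contDiff_exp_neg_norm_sq : ContDiff ℝ ⊤ fun a : X => Real.exp (-(‖a‖ ^ 2 / 2)) :=
  (((contDiff_norm_sq ℝ).div_const 2).neg).exp

theorem contDiffOn_noise (hW : IsIsonormal W) (hΨ : AEStronglyMeasurable Ψ P)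
    (hM : ∀ ω, |Ψ ω| ≤ M) :
    ContDiffOn ℝ ⊤ (fun a => ∫ ω, Ψ ω * Real.exp (W a ω) ∂P)
      (Metric.eball 0 ((1 / 2 : NNReal) : ENNReal)) :=
  (hasFPowerSeriesOnBall_noise hW hΨ hM).analyticOnNhd.contDiffOn Metric.isOpen_eball.uniqueDiffOn

/-- The Leibniz rule for the product; the resulting constant sees Ψ only through its bound `M`, and
does not depend on `W`. -/
theorem contDiffAt_wick (hW : IsIsonormal W) (hΨ : AEStronglyMeasurable Ψ P)
    (hM : ∀ ω, |Ψ ω| ≤ M) (n : ℕ) :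
    ContDiffAt ℝ n (fun a => Real.exp (-(‖a‖ ^ 2 / 2)) * ∫ ω, Ψ ω * Real.exp (W a ω) ∂P) 0 ∧
    ‖iteratedFDeriv ℝ n
      (fun a => Real.exp (-(‖a‖ ^ 2 / 2)) * ∫ ω, Ψ ω * Real.exp (W a ω) ∂P) 0‖ ≤
      smoothingConst X n * M := by
  have h0 : (0 : X) ∈ Metric.eball (0 : X) ((1 / 2 : NNReal) : ENNReal) :=
    Metric.mem_eball_self (by norm_num)
  have ho : IsOpen (Metric.eball (0 : X) ((1 / 2 : NNReal) : ENNReal)) := Metric.isOpen_eball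
  have hF := contDiffOn_noise hW hΨ hM
  have hg : ContDiffOn ℝ ⊤ (fun a : X => Real.exp (-(‖a‖ ^ 2 / 2)))
    (Metric.eball (0 : X) ((1 / 2 : NNReal) : ENNReal)) := contDiff_exp_neg_norm_sq.contDiffOn
  refine ⟨((hg.mul hF).contDiffAt (ho.mem_nhds h0)).of_le le_top, ?_⟩
  have h1 := norm_iteratedFDerivWithin_mul_le hg hF ho.uniqueDiffOn h0 (n := n) le_top
  rw [iteratedFDerivWithin_of_isOpen n ho h0] at h1
  refine h1.trans ?_
  rw [smoothingConst, Finset.sum_mul]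
  refine Finset.sum_le_sum fun i _ => ?_
  rw [iteratedFDerivWithin_of_isOpen i ho h0, iteratedFDerivWithin_of_isOpen (n - i) ho h0,
    mul_assoc (_ * _)]
  gcongr
  exact norm_iteratedFDeriv_noise_le hW hΨ hM (n - i)

variable [CompleteSpace X] [TopologicalSpace.SeparableSpace X] [MeasurableSpace X] [BorelSpace X]
variable {R : X →L[ℝ] X} {Y : Lp X 2 P}

/-- Convolution with a Gaussian vector is smooth along the range of the covariance root. -/
theorem IsImageOfNoise.contDiff_shift (hY : IsImageOfNoise W R Y) (hW : IsIsonormal W)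
    (hR : R.IsPositive) {ψ : X → ℝ} (hψ : Measurable ψ) (hM : ∀ x, |ψ x| ≤ M) (n : ℕ) :
    ContDiff ℝ n (fun a => ∫ ω, ψ (R a + Y ω) ∂P) ∧
    ∀ a, ‖iteratedFDeriv ℝ n (fun a => ∫ ω, ψ (R a + Y ω) ∂P) a‖ ≤ smoothingConst X n * M := by
  have : SecondCountableTopology X := UniformSpace.secondCountable_of_separable X
  set G : X → ℝ := fun a => ∫ ω, ψ (R a + Y ω) ∂P with hG
  -- The estimate is available only at 0. Replacing ψ by its translate by `R a₀`, which has the same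
  -- bound, recentres it at `a₀`.
  have key : ∀ a₀, ContDiffAt ℝ n (fun a => G (a + a₀)) 0 ∧
      ‖iteratedFDeriv ℝ n (fun a => G (a + a₀)) 0‖ ≤ smoothingConst X n * M := by
    intro a₀
    have hψ' : Measurable fun x => ψ (x + R a₀) := by fun_prop
    have h1 : (fun a => G (a + a₀)) = fun a => Real.exp (-(‖a‖ ^ 2 / 2)) *
        ∫ ω, ψ (Y ω + R a₀) * Real.exp (W a ω) ∂P := by
      funext a
      rw [← hY.integral_shift_eq hW hR a hψ', hG]
      simp only [map_add, add_right_comm]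
    rw [h1]
    exact contDiffAt_wick hW
      (hψ'.comp_aemeasurable (aemeasurable_Lp Y)).aestronglyMeasurable (fun ω => hM _) n
  refine ⟨contDiff_iff_contDiffAt.2 fun a₀ => ?_, fun a₀ => ?_⟩
  · have h2 : G = (fun a => G (a + a₀)) ∘ fun a => a - a₀ := by
      funext a
      simp
    rw [h2]
    refine ContDiffAt.comp a₀ ?_ (by fun_prop)
    rw [sub_self]
    exact (key a₀).1
  · have h3 := (key a₀).2
    rwa [iteratedFDeriv_comp_add_right, zero_add] at h3

end WickSeries

/-! ### Pseudo-inverses -/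

section PseudoInverse

variable {X : Type*} [NormedAddCommGroup X] [InnerProductSpace ℝ X]

theorem eq_of_mem_orthogonal_ker {R : X →L[ℝ] X} {x y : X}
    (hx : x ∈ (LinearMap.ker (R : X →ₗ[ℝ] X))ᗮ) (hy : y ∈ (LinearMap.ker (R : X →ₗ[ℝ] X))ᗮ)
    (h : R x = R y) : x = y := by
  have h1 : x - y ∈ LinearMap.ker (R : X →ₗ[ℝ] X) := by
    simp [h]
  have h2 : x - y ∈ (LinearMap.ker (R : X →ₗ[ℝ] X))ᗮ := Submodule.sub_mem _ hx hy
  rw [← sub_eq_zero, ← inner_self_eq_zero (𝕜 := ℝ)]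
  exact h2 _ h1

variable [CompleteSpace X]

theorem pinv_spec {R : X →L[ℝ] X} {y : X} (hy : y ∈ range R) :
    pinv R y ∈ (LinearMap.ker (R : X →ₗ[ℝ] X))ᗮ ∧ R (pinv R y) = y := by
  have h : ∃ x : X, x ∈ (LinearMap.ker (R : X →ₗ[ℝ] X))ᗮ ∧ R x = y := by
    obtain ⟨x, rfl⟩ := hy
    have hc : IsClosed (LinearMap.ker (R : X →ₗ[ℝ] X) : Set X) := R.isClosed_ker
    have : CompleteSpace (LinearMap.ker (R : X →ₗ[ℝ] X)) := hc.completeSpace_coe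
    obtain ⟨p, hp, q, hq, rfl⟩ :=
      Submodule.exists_add_mem_mem_orthogonal (K := LinearMap.ker (R : X →ₗ[ℝ] X)) x
    refine ⟨q, hq, ?_⟩
    have : R p = 0 := hp
    rw [map_add, this, zero_add]
  have h' : pinv R y = h.choose := dif_pos h
  rw [h']
  exact h.choose_spec

/-- If the range of `V` lies in that of `R`, then `R⁻¹ V` is linear. -/
def pinvComp (R V : X →L[ℝ] X) (h : range V ⊆ range R) : X →ₗ[ℝ] X where
  toFun x := pinv R (V x)
  map_add' x y := by
    have hx := pinv_spec (h ⟨x, rfl⟩)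
    have hy := pinv_spec (h ⟨y, rfl⟩)
    have hxy := pinv_spec (h ⟨x + y, rfl⟩)
    refine eq_of_mem_orthogonal_ker hxy.1 (Submodule.add_mem _ hx.1 hy.1) ?_
    rw [map_add R, hx.2, hy.2, hxy.2, map_add]
  map_smul' c x := by
    have hx := pinv_spec (h ⟨x, rfl⟩)
    have hcx := pinv_spec (h ⟨c • x, rfl⟩)
    refine eq_of_mem_orthogonal_ker hcx.1 (Submodule.smul_mem _ _ hx.1) ?_
    rw [RingHom.id_apply, map_smul R, hx.2, hcx.2, map_smul]

end PseudoInverse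

/-! ### Lipschitz approximation of Hölder functions -/

section InfConvolution

variable {X : Type*} [NormedAddCommGroup X]

/-- For r ≤ ε the first term suffices; for r > ε, r^(α-1) ≤ ε^(α-1) because the exponent is
negative. -/
theorem rpow_le_add_of_pos {α ε r : ℝ} (h0 : 0 < α) (h1 : α < 1) (hε : 0 < ε) (hr : 0 ≤ r) :
    r ^ α ≤ ε ^ α + ε ^ (α - 1) * r := by
  rcases le_or_gt r ε with h | h
  · have := Real.rpow_le_rpow hr h h0.le
    have h2 : 0 ≤ ε ^ (α - 1) * r := by positivity
    linarith
  · have hr' : 0 < r := hε.trans h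
    have h2 : r ^ (α - 1) ≤ ε ^ (α - 1) :=
      Real.rpow_le_rpow_of_nonpos hε h.le (by linarith)
    have h3 : r ^ α = r ^ (α - 1) * r := by
      rw [Real.rpow_sub_one hr'.ne', div_mul_cancel₀ _ hr'.ne']
    have h4 : 0 < ε ^ α := by positivity
    rw [h3]
    nlinarith

/-- A bounded Hölder function is approximated by Lipschitz ones (its inf-convolutions). -/
theorem exists_lipschitz_approx {α ε H b : ℝ} (h0 : 0 < α) (h1 : α < 1) (hε : 0 < ε) (hH : 0 ≤ H)
    {φ : X → ℝ} (hb : ∀ x, |φ x| ≤ b) (hφ : ∀ x h, |φ (x + h) - φ x| ≤ H * ‖h‖ ^ α) :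
    ∃ g : X → ℝ, (∀ x h, |g (x + h) - g x| ≤ H * ε ^ (α - 1) * ‖h‖) ∧
      ∀ x, |φ x - g x| ≤ H * ε ^ α := by
  set L := H * ε ^ (α - 1) with hL
  have hL0 : 0 ≤ L := by positivity
  -- Boundedness of φ makes the infimum genuine; a real infimum over a set unbounded below is 0 by
  -- convention.
  have hbdd : ∀ x, BddBelow (range fun y => φ y + L * ‖x - y‖) := fun x => by
    refine ⟨-b, ?_⟩
    rintro _ ⟨y, rfl⟩
    have := (abs_le.1 (hb y)).1
    have : 0 ≤ L * ‖x - y‖ := by positivity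
    simp only
    linarith
  set g : X → ℝ := fun x => ⨅ y, φ y + L * ‖x - y‖ with hg
  have hlip : ∀ x y, g x ≤ g y + L * ‖x - y‖ := fun x y => by
    rw [← sub_le_iff_le_add]
    refine le_ciInf fun z => ?_
    have h2 := ciInf_le (hbdd x) z
    have h3 : L * ‖x - z‖ ≤ L * ‖x - y‖ + L * ‖y - z‖ := by
      rw [← mul_add]
      exact mul_le_mul_of_nonneg_left (norm_sub_le_norm_sub_add_norm_sub x y z) hL0
    have h4 : g x ≤ φ z + L * ‖x - z‖ := h2
    linarith
  refine ⟨g, fun x h => ?_, fun x => ?_⟩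
  · have h2 := hlip (x + h) x
    have h3 := hlip x (x + h)
    rw [add_sub_cancel_left] at h2
    rw [sub_add_cancel_left, norm_neg] at h3
    rw [abs_le]
    constructor <;> linarith
  · have h2 : g x ≤ φ x := by
      have := ciInf_le (hbdd x) x
      simpa using this
    -- For every y, φ(x) - φ(y) ≤ H‖x-y‖^α ≤ Hε^α + L‖x-y‖.
    have h3 : φ x - H * ε ^ α ≤ g x := by
      refine le_ciInf fun y => ?_
      have h4 := (abs_le.1 (hφ y (x - y))).2
      rw [add_sub_cancel] at h4
      have h5 := mul_le_mul_of_nonneg_left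
        (rpow_le_add_of_pos h0 h1 hε (norm_nonneg (x - y))) hH
      rw [mul_add, ← mul_assoc] at h5
      linarith
    rw [abs_le]
    constructor <;> [skip; linarith]
    have : 0 ≤ H * ε ^ α := by positivity
    linarith

end InfConvolution

/-! ### Supremum norm and Hölder seminorm -/

section Norms

variable {X : Type*}

theorem abs_le_supNorm {φ : X → ℝ} (hb : ∃ b : ℝ, ∀ x, |φ x| ≤ b) (x : X) : |φ x| ≤ supNorm φ := by
  obtain ⟨b, hb⟩ := hb
  exact le_ciSup (f := fun x => |φ x|) ⟨b, by rintro _ ⟨y, rfl⟩; exact hb y⟩ x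

theorem supNorm_nonneg (φ : X → ℝ) : 0 ≤ supNorm φ := Real.iSup_nonneg fun _ => abs_nonneg _

variable [NormedAddCommGroup X]

theorem holderSeminorm_nonneg (α : ℝ) (φ : X → ℝ) : 0 ≤ holderSeminorm α φ :=
  Real.iSup_nonneg fun _ => by positivity

theorem abs_sub_le_holderSeminorm {α : ℝ} (h0 : 0 < α) {φ : X → ℝ}
    (hc : ∃ c : ℝ, ∀ x h, |φ (x + h) - φ x| ≤ c * ‖h‖ ^ α) (x h : X) :
    |φ (x + h) - φ x| ≤ holderSeminorm α φ * ‖h‖ ^ α := by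
  obtain ⟨c, hc⟩ := hc
  rcases eq_or_ne h 0 with rfl | hh
  · simp [Real.zero_rpow h0.ne']
  · have hpos : ∀ k : X, k ≠ 0 → 0 < ‖k‖ ^ α := fun k hk =>
      Real.rpow_pos_of_pos (norm_pos_iff.2 hk) _
    rw [← div_le_iff₀ (hpos h hh)]
    refine le_ciSup (f := fun p : X × {h : X // h ≠ 0} =>
      |φ (p.1 + p.2) - φ p.1| / ‖(p.2 : X)‖ ^ α) ⟨c, ?_⟩ (x, ⟨h, hh⟩)
    rintro _ ⟨p, rfl⟩
    simp only
    rw [div_le_iff₀ (hpos _ p.2.2)]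
    exact hc _ _

end Norms

/-! ### Gaussian measures with trace class covariance -/

section Gaussian

universe u

variable {X : Type u} [NormedAddCommGroup X] [InnerProductSpace ℝ X] [CompleteSpace X]
    [TopologicalSpace.SeparableSpace X] [MeasurableSpace X] [BorelSpace X]

/-- The centred Gaussian measure with trace class covariance `Q`: all `𝒩_{m,Q}` are translates of
it, and convolution with it is smoothing along the range of `Q^{1/2}`. -/
theorem exists_centered_gaussian {Q : X → X} (hQ : IsNonnegTraceClass Q) :
    ∃ μ : Measure X, IsProbabilityMeasure μ ∧
      (∀ m, gaussianMeasure m Q = μ.map fun y => m + y) ∧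
      ∀ (ψ : X → ℝ) (M : ℝ) (n : ℕ), Measurable ψ → (∀ x, |ψ x| ≤ M) →
        ContDiff ℝ n (fun a => ∫ y, ψ (opSqrt Q a + y) ∂μ) ∧
        ∀ a, ‖iteratedFDeriv ℝ n (fun a => ∫ y, ψ (opSqrt Q a + y) ∂μ) a‖ ≤
          smoothingConst X n * M := by
  have : SecondCountableTopology X := UniformSpace.secondCountable_of_separable X
  obtain ⟨A, hAQ, hA, w, b, hsum⟩ := hQ
  obtain ⟨hR, hRR⟩ := opSqrt_spec hAQ hA
  have hRRQ : ∀ x, opSqrt Q (opSqrt Q x) = Q x := fun x => by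
    rw [← hAQ, ← hRR]
    rfl
  obtain ⟨W, hW⟩ := exists_isIsonormal b
  -- The trace of `Q` is the squared Hilbert–Schmidt norm of its root: ⟨Q bᵢ, bᵢ⟩ = ‖Q^{1/2} bᵢ‖².
  have hsum' : Summable fun i => ‖opSqrt Q (b i)‖ ^ 2 := by
    refine hsum.congr fun i => ?_
    rw [hAQ, ← hRRQ, hR.inner_left_eq_inner_right, real_inner_self_eq_norm_sq]
  obtain ⟨Y, hY⟩ := exists_isImageOfNoise (W := W) b hsum'
  have hYm := aemeasurable_Lp Y
  refine ⟨Measure.map Y _, Measure.isProbabilityMeasure_map hYm, fun m => ?_, ?_⟩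
  · rw [hY.gaussianMeasure_eq hW hR hRRQ,
      AEMeasurable.map_map_of_aemeasurable (by fun_prop) hYm]
    rfl
  · intro ψ M n hψ hM
    have h1 : ∀ a, ∫ y, ψ (opSqrt Q a + y) ∂(Measure.map Y
        (Measure.infinitePi fun _ : w => gaussianReal 0 1)) =
        ∫ ω, ψ (opSqrt Q a + Y ω) ∂(Measure.infinitePi fun _ : w => gaussianReal 0 1) := fun a =>
      integral_map hYm (hψ.comp (measurable_const_add _)).aestronglyMeasurable
    simp_rw [h1]
    exact hY.contDiff_shift hW hR hψ hM n

end Gaussian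

/-! ### Smoothing by the evolution operators -/

section Evolution

variable {X : Type*} [NormedAddCommGroup X] [InnerProductSpace ℝ X] [CompleteSpace X]
variable {T C θ : ℝ} {U : ℝ → ℝ → X →L[ℝ] X} {B : ℝ → X →L[ℝ] X} {f : ℝ → X}

/-- The evolution operators are uniformly bounded. -/
theorem H1.exists_norm_U_le (h1 : H1 T U B f) :
    ∃ M : ℝ, 0 ≤ M ∧ ∀ s t, 0 ≤ s → s ≤ t → t ≤ T → ‖U t s‖ ≤ M := by
  let K : Set (ℝ × ℝ) := {p | 0 ≤ p.1 ∧ p.1 ≤ p.2 ∧ p.2 ≤ T}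
  have hK : IsCompact K := by
    refine (isCompact_Icc (a := (0 : ℝ)) (b := T)).prod (isCompact_Icc (a := (0 : ℝ)) (b := T))
      |>.of_isClosed_subset ?_ ?_
    · exact (isClosed_le continuous_const continuous_fst).inter
        ((isClosed_le continuous_fst continuous_snd).inter
          (isClosed_le continuous_snd continuous_const))
    · rintro ⟨s, t⟩ ⟨h0, h1, h2⟩
      exact ⟨⟨h0, h1.trans h2⟩, ⟨h0.trans h1, h2⟩⟩
  -- Each orbit is bounded, being continuous on a compact triangle, so uniform boundedness applies.
  obtain ⟨M, hM⟩ := banach_steinhaus (g := fun p : K => U p.1.2 p.1.1) fun x => by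
    obtain ⟨c, hc⟩ := hK.exists_bound_of_continuousOn (h1.continuous_U x)
    exact ⟨c, fun p => hc p.1 p.2⟩
  exact ⟨max M 0, le_max_right _ _, fun s t h0 h1 h2 =>
    (hM ⟨(s, t), h0, h1, h2⟩).trans (le_max_left _ _)⟩

/-- The factorisation U = Q^{1/2}Λ turns smoothness along the range of Q^{1/2} into smoothness on
`X`. Using `|C|` keeps the bound nonnegative without assuming a sign for `C`. -/
theorem exists_lam_clm (h2 : H2 T U B) (h3 : LamBound T U B C θ) {s t : ℝ} (hs : 0 ≤ s)
    (hst : s < t) (ht : t ≤ T) :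
    ∃ L : X →L[ℝ] X, (∀ x, opSqrt (covOp U B t s) (L x) = U t s x) ∧
      ‖L‖ ≤ |C| * (t - s) ^ (-θ) := by
  have hsub := h2 s t hs hst ht
  have hpos : 0 ≤ (t - s) ^ (-θ) := Real.rpow_nonneg (by linarith) _
  have hbd : ∀ x, ‖pinvComp (opSqrt (covOp U B t s)) (U t s) hsub x‖ ≤
      |C| * (t - s) ^ (-θ) * ‖x‖ := fun x => by
    refine (h3 s t hs hst ht x).trans ?_
    gcongr
    exact le_abs_self C
  exact ⟨(pinvComp _ _ hsub).mkContinuous _ hbd, fun x => (pinv_spec (hsub ⟨x, rfl⟩)).2,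
    LinearMap.mkContinuous_norm_le _ (by positivity) hbd⟩

variable [TopologicalSpace.SeparableSpace X] [MeasurableSpace X] [BorelSpace X]

theorem IsNonnegTraceClass.isProbabilityMeasure_gaussianMeasure {Q : X → X}
    (hQ : IsNonnegTraceClass Q) (m : X) : IsProbabilityMeasure (gaussianMeasure m Q) := by
  obtain ⟨μ, hμ, h, -⟩ := exists_centered_gaussian hQ
  rw [h]
  exact Measure.isProbabilityMeasure_map (by fun_prop)

theorem evol_add (hQ : ∀ s t, 0 ≤ s → s ≤ t → t ≤ T → IsNonnegTraceClass (covOp U B t s))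
    {s t : ℝ} (hs : 0 ≤ s) (hst : s ≤ t) (ht : t ≤ T) {φ ψ : X → ℝ} (hφ : IsBddBorel φ)
    (hψ : IsBddBorel ψ) :
    evol U B f s t (fun x => φ x + ψ x) = fun x => evol U B f s t φ x + evol U B f s t ψ x := by
  funext x
  have := (hQ s t hs hst ht).isProbabilityMeasure_gaussianMeasure (meanVec U f t s x)
  obtain ⟨hφm, b, hb⟩ := hφ
  obtain ⟨hψm, c, hc⟩ := hψ
  exact integral_add
    (Integrable.of_bound hφm.aestronglyMeasurable b (Filter.Eventually.of_forall hb))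
    (Integrable.of_bound hψm.aestronglyMeasurable c (Filter.Eventually.of_forall hc))

/-- The mean at x + h is the mean at x shifted by U(t,s)h, while the covariance does not depend on
x. -/
theorem evol_comp_add (hQ : ∀ s t, 0 ≤ s → s ≤ t → t ≤ T → IsNonnegTraceClass (covOp U B t s))
    {s t : ℝ} (hs : 0 ≤ s) (hst : s ≤ t) (ht : t ≤ T) {φ : X → ℝ} (hφ : Measurable φ) (h : X) :
    evol U B f s t (fun x => φ (x + U t s h)) = fun x => evol U B f s t φ (x + h) := by
  funext x
  have : SecondCountableTopology X := UniformSpace.secondCountable_of_separable X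
  obtain ⟨μ, hμ, hmap, -⟩ := exists_centered_gaussian (hQ s t hs hst ht)
  simp only [evol, hmap]
  rw [integral_map (by fun_prop) (Measurable.aestronglyMeasurable (by fun_prop)),
    integral_map (by fun_prop) hφ.aestronglyMeasurable]
  simp only [meanVec, map_add, add_right_comm]

/-- Smoothing of bounded Borel functions. -/
theorem contDiff_evol (h1 : H1 T U B f) (h2 : H2 T U B) (h3 : LamBound T U B C θ) {s t : ℝ}
    (hs : 0 ≤ s) (hst : s < t) (ht : t ≤ T) {φ : X → ℝ} (hφ : Measurable φ) {M : ℝ}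
    (hM : ∀ x, |φ x| ≤ M) (n : ℕ) :
    ContDiff ℝ n (evol U B f s t φ) ∧ ∀ x, ‖iteratedFDeriv ℝ n (evol U B f s t φ) x‖ ≤
      smoothingConst X n * |C| ^ n * (t - s) ^ (-(n * θ)) * M := by
  have : SecondCountableTopology X := UniformSpace.secondCountable_of_separable X
  obtain ⟨μ, hμ, hmap, hsmooth⟩ := exists_centered_gaussian (h1.traceClass_Q s t hs hst.le ht)
  obtain ⟨L, hL, hLn⟩ := exists_lam_clm h2 h3 hs hst ht
  have hts : 0 < t - s := by linarith
  have hM0 : 0 ≤ M := (abs_nonneg _).trans (hM 0)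
  set c := ∫ r in s..t, U t r (f r)
  set G : X → ℝ := fun a => ∫ y, φ (c + (opSqrt (covOp U B t s) a + y)) ∂μ
  -- The drift `c` is absorbed into the test function, so x enters only through Λx.
  have hrepr : evol U B f s t φ = G ∘ L := by
    funext x
    simp only [evol, hmap, G, Function.comp_apply, hL]
    rw [integral_map (by fun_prop) hφ.aestronglyMeasurable]
    refine integral_congr_ae (Filter.Eventually.of_forall fun y => ?_)
    simp only [meanVec]
    congr 1
    abel
  obtain ⟨hG1, hG2⟩ := hsmooth (fun x => φ (c + x)) M n (by fun_prop) fun x => hM _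
  rw [hrepr]
  refine ⟨hG1.comp L.contDiff, fun x => ?_⟩
  rw [L.iteratedFDeriv_comp_right hG1 x le_rfl]
  refine (ContinuousMultilinearMap.norm_compContinuousLinearMap_le _ _).trans ?_
  rw [Finset.prod_const, Finset.card_univ, Fintype.card_fin]
  calc ‖iteratedFDeriv ℝ n G (L x)‖ * ‖L‖ ^ n
      ≤ (smoothingConst X n * M) * (|C| * (t - s) ^ (-θ)) ^ n := by
        gcongr
        · exact mul_nonneg (smoothingConst_nonneg n) hM0
        · exact hG2 _
    _ = smoothingConst X n * |C| ^ n * (t - s) ^ (-(n * θ)) * M := by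
        rw [mul_pow, ← Real.rpow_mul_natCast hts.le]
        have : -θ * n = -(n * θ) := by ring
        rw [this]
        ring

/-- One derivative is gained, at no cost in time, on Lipschitz functions. -/
theorem norm_iteratedFDeriv_evol_le_of_lipschitz (h1 : H1 T U B f) (h2 : H2 T U B)
    (h3 : LamBound T U B C θ) {s t : ℝ} (hs : 0 ≤ s) (hst : s < t) (ht : t ≤ T) {φ : X → ℝ}
    (hφ : Measurable φ) {M : ℝ} (hM : ∀ x, |φ x| ≤ M) {L : ℝ} (hL0 : 0 ≤ L)
    (hL : ∀ x h, |φ (x + h) - φ x| ≤ L * ‖h‖) (n : ℕ) (x : X) :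
    ‖iteratedFDeriv ℝ (n + 1) (evol U B f s t φ) x‖ ≤
      smoothingConst X n * |C| ^ n * (t - s) ^ (-(n * θ)) * (L * ‖U t s‖) := by
  have hts : 0 < t - s := by linarith
  rw [← norm_fderiv_iteratedFDeriv]
  have hk := smoothingConst_nonneg (X := X) n
  -- It suffices to bound increments of the n-th derivative. The increment by `h` is the n-th
  -- derivative of P_{s,t} applied to φ(· + Uh) - φ, whose supremum is at most L‖U‖‖h‖.
  refine norm_fderiv_le_of_lip' ℝ (by positivity) (Filter.Eventually.of_forall fun y => ?_)
  set h := y - x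
  have hdiffm : Measurable fun z => φ (z + U t s h) := by fun_prop
  have hnegm : Measurable fun z => -φ z := hφ.neg
  have hd : ∀ z, |φ (z + U t s h) + -φ z| ≤ L * (‖U t s‖ * ‖h‖) := fun z => by
    rw [← sub_eq_add_neg]
    refine (hL z _).trans ?_
    gcongr
    exact (U t s).le_opNorm h
  have hsum := evol_add (f := f) h1.traceClass_Q hs hst.le ht
    (φ := fun z => φ (z + U t s h)) (ψ := fun z => -φ z)
    ⟨hdiffm, M, fun z => hM _⟩ ⟨hnegm, M, fun z => by rw [abs_neg]; exact hM z⟩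
  have hneg : evol U B f s t (fun z => -φ z) = fun z => -evol U B f s t φ z := by
    funext z
    exact integral_neg _
  rw [evol_comp_add h1.traceClass_Q hs hst.le ht hφ, hneg] at hsum
  have hc := (contDiff_evol h1 h2 h3 hs hst ht hφ hM n).1
  have hbound := (contDiff_evol h1 h2 h3 hs hst ht (hdiffm.add hnegm) hd n).2 x
  have hcalc : iteratedFDeriv ℝ n (fun z => evol U B f s t φ (z + h) + -evol U B f s t φ z) x =
      iteratedFDeriv ℝ n (evol U B f s t φ) y - iteratedFDeriv ℝ n (evol U B f s t φ) x := by
    have hc' : ContDiff ℝ n fun z => evol U B f s t φ (z + h) := hc.comp (by fun_prop)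
    have h4 := iteratedFDeriv_add_apply (x := x) hc'.contDiffAt hc.neg.contDiffAt
    have h5 : iteratedFDeriv ℝ n (-evol U B f s t φ) x = -iteratedFDeriv ℝ n (evol U B f s t φ) x :=
      iteratedFDeriv_neg_apply
    have h6 := iteratedFDeriv_comp_add_right (𝕜 := ℝ) (f := evol U B f s t φ) n h x
    have h7 : x + h = y := by simp [h]
    rw [h6, h7, show (fun z => -evol U B f s t φ z) = -evol U B f s t φ from rfl, h5,
      ← sub_eq_add_neg] at h4
    exact h4
  rw [← hcalc, ← hsum]
  refine hbound.trans (le_of_eq ?_)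
  ring

/-- Smoothing of bounded Hölder functions. -/
theorem contDiff_evol_of_holder (h1 : H1 T U B f) (h2 : H2 T U B) (h3 : LamBound T U B C θ)
    {MU : ℝ} (hMU : ∀ s t, 0 ≤ s → s ≤ t → t ≤ T → ‖U t s‖ ≤ MU) {s t : ℝ}
    (hs : 0 ≤ s) (hst : s < t) (ht : t ≤ T) {α : ℝ} (hα0 : 0 < α) (hα1 : α < 1) {φ : X → ℝ}
    (hφ : IsBddHolder α φ) (n : ℕ) (x : X) :
    ‖iteratedFDeriv ℝ (n + 1) (evol U B f s t φ) x‖ ≤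
      (smoothingConst X (n + 1) * |C| ^ (n + 1) + smoothingConst X n * |C| ^ n * MU) *
        (t - s) ^ (-(((n + 1 : ℕ) - α) * θ)) * holderSeminorm α φ := by
  obtain ⟨hcont, ⟨b, hb⟩, hc⟩ := hφ
  have hts : 0 < t - s := by linarith
  set H := holderSeminorm α φ
  have hH : 0 ≤ H := holderSeminorm_nonneg α φ
  -- The scale ε = (t-s)^θ equalises (t-s)^(-(n+1)θ) ε^α and (t-s)^(-nθ) ε^(α-1).
  have hε : 0 < (t - s) ^ θ := Real.rpow_pos_of_pos hts _
  obtain ⟨g, hg1, hg2⟩ := exists_lipschitz_approx hα0 hα1 hε hH hb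
    (abs_sub_le_holderSeminorm hα0 hc)
  set ε := (t - s) ^ θ with hεdef
  have hL0 : 0 ≤ H * ε ^ (α - 1) := by positivity
  have hgcont : Continuous g := by
    refine LipschitzWith.continuous (K := ⟨H * ε ^ (α - 1), hL0⟩)
      (LipschitzWith.of_dist_le_mul fun y z => ?_)
    have := hg1 z (y - z)
    rw [add_sub_cancel] at this
    rw [Real.dist_eq, dist_eq_norm]
    exact this
  -- Only the boundedness of `g` matters; this bound does not enter the final estimate.
  have hgb : ∀ x, |g x| ≤ b + H * ε ^ α := fun x => by
    have h4 := abs_le.1 (hg2 x)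
    have h5 := abs_le.1 (hb x)
    rw [abs_le]
    constructor <;> linarith [h4.1, h4.2, h5.1, h5.2]
  have hφm : Measurable φ := hcont.measurable
  have hgm : Measurable g := hgcont.measurable
  have hdm : Measurable fun x => φ x - g x := hφm.sub hgm
  have hsum := evol_add (f := f) h1.traceClass_Q hs hst.le ht (φ := fun x => φ x - g x) (ψ := g)
    ⟨hdm, _, hg2⟩ ⟨hgm, _, hgb⟩
  simp only [sub_add_cancel] at hsum
  obtain ⟨hc1, hd1⟩ := contDiff_evol h1 h2 h3 hs hst ht hdm hg2 (n + 1)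
  have hc2 := (contDiff_evol h1 h2 h3 hs hst ht hgm hgb (n + 1)).1
  have hd2 := norm_iteratedFDeriv_evol_le_of_lipschitz h1 h2 h3 hs hst ht hgm hgb hL0 hg1 n x
  have hφe : (fun x => φ x) = φ := rfl
  rw [hφe] at hsum
  rw [hsum]
  have h4 := iteratedFDeriv_add_apply (x := x) hc1.contDiffAt hc2.contDiffAt
  have h5 : iteratedFDeriv ℝ (n + 1)
      (fun x => evol U B f s t (fun x => φ x - g x) x + evol U B f s t g x) x = _ := h4
  rw [h5]
  refine (norm_add_le _ _).trans ((add_le_add (hd1 x) hd2).trans ?_)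
  have hk := smoothingConst_nonneg (X := X) n
  have hU : ‖U t s‖ ≤ MU := hMU s t hs hst.le ht
  have hp1 : (t - s) ^ (-((n + 1 : ℕ) * θ)) * ε ^ α = (t - s) ^ (-(((n + 1 : ℕ) - α) * θ)) := by
    rw [hεdef, ← Real.rpow_mul hts.le, ← Real.rpow_add hts]
    congr 1
    ring
  have hp2 : (t - s) ^ (-(n * θ)) * ε ^ (α - 1) = (t - s) ^ (-(((n + 1 : ℕ) - α) * θ)) := by
    rw [hεdef, ← Real.rpow_mul hts.le, ← Real.rpow_add hts]
    congr 1
    push_cast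
    ring
  calc _ ≤ smoothingConst X (n + 1) * |C| ^ (n + 1) * (t - s) ^ (-((n + 1 : ℕ) * θ)) *
          (H * ε ^ α) + smoothingConst X n * |C| ^ n * (t - s) ^ (-(n * θ)) *
            (H * ε ^ (α - 1) * MU) := by gcongr
    _ = smoothingConst X (n + 1) * |C| ^ (n + 1) * ((t - s) ^ (-((n + 1 : ℕ) * θ)) * ε ^ α) * H +
        smoothingConst X n * |C| ^ n * MU * ((t - s) ^ (-(n * θ)) * ε ^ (α - 1)) * H := by ring
    _ = _ := by
        rw [hp1, hp2]
        ring

end Evolution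

end OUEvolution

end

/-! ### The two derivative estimates -/

theorem mainTheorem6 {X : Type*} [NormedAddCommGroup X] [InnerProductSpace ℝ X] [CompleteSpace X]
    [TopologicalSpace.SeparableSpace X] [MeasurableSpace X] [BorelSpace X]
    (T : ℝ) (U : ℝ → ℝ → X →L[ℝ] X) (B : ℝ → X →L[ℝ] X) (f : ℝ → X) (C θ : ℝ) (hθ : 0 < θ)
    (h1 : OUEvolution.H1 T U B f) (h2 : OUEvolution.H2 T U B)
    (h3 : OUEvolution.LamBound T U B C θ) :
    (∀ n : ℕ, 1 ≤ n → ∃ K : ℝ, 0 < K ∧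
      ∀ s t : ℝ, 0 ≤ s → s < t → t ≤ T → ∀ φ : X → ℝ, OUEvolution.IsBddBorel φ →
        ContDiff ℝ n (OUEvolution.evol U B f s t φ) ∧
        ∀ x : X, ‖iteratedFDeriv ℝ n (OUEvolution.evol U B f s t φ) x‖
          ≤ K / (t - s) ^ ((n : ℝ) * θ) * OUEvolution.supNorm φ) ∧
    (∀ α : ℝ, 0 < α → α < 1 → ∀ n : ℕ, 1 ≤ n → ∃ K : ℝ, 0 < K ∧
      ∀ s t : ℝ, 0 ≤ s → s < t → t ≤ T → ∀ φ : X → ℝ, OUEvolution.IsBddHolder α φ →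
        ContDiff ℝ n (OUEvolution.evol U B f s t φ) ∧
        ∀ x : X, ‖iteratedFDeriv ℝ n (OUEvolution.evol U B f s t φ) x‖
          ≤ K / (t - s) ^ (((n : ℝ) - α) * θ) * OUEvolution.holderNorm α φ) := by
  have hk : ∀ n, 0 ≤ OUEvolution.smoothingConst X n := OUEvolution.smoothingConst_nonneg
  -- The added 1 makes the constant strictly positive even when `C = 0`.
  refine ⟨fun n _ => ⟨OUEvolution.smoothingConst X n * |C| ^ n + 1, ?_, ?_⟩,
    fun α hα0 hα1 n hn => ?_⟩
  · have := hk n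
    positivity
  · intro s t hs hst ht φ hφ
    have hts : 0 < t - s := by linarith
    obtain ⟨hc, hd⟩ := OUEvolution.contDiff_evol h1 h2 h3 hs hst ht hφ.1
      (OUEvolution.abs_le_supNorm hφ.2) n
    refine ⟨hc, fun x => (hd x).trans ?_⟩
    rw [Real.rpow_neg hts.le, div_eq_mul_inv]
    have := OUEvolution.supNorm_nonneg φ
    gcongr
    linarith
  · obtain ⟨MU, hMU0, hMU⟩ := h1.exists_norm_U_le
    -- One derivative falls on the Lipschitz part, so the order must be at least 1.
    obtain ⟨m, rfl⟩ : ∃ m, n = m + 1 := ⟨n - 1, by omega⟩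
    refine ⟨OUEvolution.smoothingConst X (m + 1) * |C| ^ (m + 1) +
      OUEvolution.smoothingConst X m * |C| ^ m * MU + 1, ?_, ?_⟩
    · have := hk (m + 1)
      have := hk m
      positivity
    · intro s t hs hst ht φ hφ
      have hts : 0 < t - s := by linarith
      refine ⟨(OUEvolution.contDiff_evol h1 h2 h3 hs hst ht hφ.1.measurable
        (OUEvolution.abs_le_supNorm hφ.2.1) (m + 1)).1, fun x => ?_⟩
      refine (OUEvolution.contDiff_evol_of_holder h1 h2 h3 hMU hs hst ht hα0 hα1 hφ m x).trans ?_
      rw [Real.rpow_neg hts.le, div_eq_mul_inv]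
      have h4 := hk (m + 1)
      have h5 := hk m
      have h6 := OUEvolution.holderSeminorm_nonneg α φ
      have h7 : OUEvolution.holderSeminorm α φ ≤ OUEvolution.holderNorm α φ :=
        le_add_of_nonneg_left (OUEvolution.supNorm_nonneg φ)
      exact mul_le_mul (mul_le_mul_of_nonneg_right (le_add_of_nonneg_right zero_le_one)
        (by positivity)) h7 h6 (by positivity)
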